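/- Write points of $\mathbb{R}^6=\mathbb{R}^3\times\mathbb{R}^3$ as $z=(x,v)$. Let $V\in C^2_b(\mathbb{R}^3)$, i.e. $V:\mathbb{R}^3\to\mathbb{R}$ is twice continuously differentiable and $V$, $\nabla V$, $D^2V$ are bounded. Let $\mathcal{M}$ be the space of finite signed Borel measures on $\mathbb{R}^6$, with $\|\mu\|=\sup_B|\mu(B)|$, the supremum over Borel sets $B\subset\mathbb{R}^6$. For an open interval $\Delta\subset\mathbb{R}$ (possibly unbounded), let $\mathcal{M}_\Delta$ be the set of families $\{\mu_t\}_{t\in\Delta}\subset\mathcal{M}$ such that $\sup_{t\in\Delta'}\|\mu_t\|<\infty$ for every bounded interval $\Delta'\subset\Delta$, and such that $t\mapsto(\nabla V*\mu_t)(x)=\int\nabla V(x-x')\,d\mu_t(x',v')$ is continuous on $\Delta$ for every $x\in\mathbb{R}^3$. Put $A(x,v)=(2v,0)$, $B(x,v)=(0,\nabla V(x))$ and $B_\mu(z)=\int B(z-w)\,d\mu(w)$. A family $\{\mu_t\}_{t\in\Delta}\in\mathcal{M}_\Delta$ is a weak solution of the Vlasov equation on $\Delta$ if, for every test function $h$,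 the function $t\mapsto\mu_t(h)=\int h\,d\mu_t$ is differentiable on $\Delta$ and $$\frac{d}{dt}\,\mu_t(h)=\mu_t\big((A+B_{\mu_t})\cdot\nabla h\big)\qquad (t\in\Delta).$$ Then for every $\mu^0\in\mathcal{M}$ and every open interval $\Delta$ containing $0$ there is a unique weak solution $\{\mu_t\}_{t\in\Delta}$ of the Vlasov equation on $\Delta$ with $\mu_0=\mu^0$. This holds both when the test functions are all $h\in C_c^\infty(\mathbb{R}^6)$ and when they are all Schwartz functions $h\in\mathcal{S}(\mathbb{R}^6)$. (Since $V$ may be replaced by $-V$, the sign in front of $\nabla V$ in $B$ is immaterial.) -/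

import Mathlib

open MeasureTheory Set
open scoped ENNReal NNReal ContDiff SchwartzMap Gradient

noncomputable section

namespace Vlasov

/-- Physical space `ℝ³` with the Euclidean structure. -/
abbrev R3 : Type := EuclideanSpace ℝ (Fin 3)

/-- Phase space `ℝ⁶ = ℝ³ × ℝ³`, with points `z = (x, v)`. Its measurable structure is the Borel
σ-algebra. -/
abbrev Phase : Type := R3 × R3

/-- `V ∈ C²_b(ℝ³)`: `V` is twice continuously differentiable, and `V` and its derivatives of order
one and two are bounded. -/
def IsC2b (V : R3 → ℝ) : Prop :=
  ContDiff ℝ 2 V ∧ ∀ k : ℕ, k ≤ 2 → ∃ C : ℝ, ∀ x : R3, ‖iteratedFDeriv ℝ k V x‖ ≤ C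

/-- The norm `‖μ‖ = sup_B |μ(B)|` over Borel sets `B`, with values in `[0, ∞]`. -/
def supNorm (μ : SignedMeasure Phase) : ℝ≥0∞ :=
  ⨆ (B : Set Phase) (_ : MeasurableSet B), ‖μ B‖ₑ

/-- `(∇V * μ)(x) = ∫ ∇V(x - x') dμ(x', v')`. -/
def gradConv (V : R3 → ℝ) (μ : SignedMeasure Phase) (x : R3) : R3 :=
  ∫ᵛ w, ∇ V (x - w.1) ∂<•μ

/-- The class `M_Δ` of families of finite signed measures whose norms are bounded on each bounded
subinterval of `Δ`, and for which `t ↦ (∇V * μ_t)(x)` is continuous on `Δ` for each `x`. Only the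
values `M t` with `t ∈ Δ` matter. -/
structure IsFamily (V : R3 → ℝ) (Δ : Set ℝ) (M : ℝ → SignedMeasure Phase) : Prop where
  bounded : ∀ I : Set ℝ, I ⊆ Δ → I.OrdConnected → Bornology.IsBounded I →
    ∃ C : ℝ≥0, ⨆ t ∈ I, supNorm (M t) < C
  continuous : ∀ x : R3, ContinuousOn (fun t => gradConv V (M t) x) Δ

/-- `A(x, v) = (2v, 0)`. -/
def fieldA (z : Phase) : Phase := ((2 : ℝ) • z.2, 0)

/-- `B(x, v) = (0, ∇V(x))`. -/
def fieldB (V : R3 → ℝ) (z : Phase) : Phase := (0, ∇ V z.1)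

/-- `B_μ(z) = ∫ B(z - w) dμ(w)`. -/
def fieldBConv (V : R3 → ℝ) (μ : SignedMeasure Phase) (z : Phase) : Phase :=
  ∫ᵛ w, fieldB V (z - w) ∂<•μ

/-- The smooth compactly supported functions on `ℝ⁶`. -/
def compactTests : Set (Phase → ℝ) := {h | ContDiff ℝ ∞ h ∧ HasCompactSupport h}

/-- The rapidly decreasing (Schwartz) functions on `ℝ⁶`. -/
def schwartzTests : Set (Phase → ℝ) := Set.range fun h : 𝓢(Phase, ℝ) => (h : Phase → ℝ)

/-- `M` is a weak solution of the Vlasov equation on `Δ`, tested against the functions in `𝒯`: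
`M` belongs to `M_Δ`, and for all `h ∈ 𝒯` the function `t ↦ μ_t(h)` is differentiable on `Δ` with
derivative `μ_t((A + B_{μ_t}) · ∇h)`. -/
structure IsWeakSolution (𝒯 : Set (Phase → ℝ)) (V : R3 → ℝ) (Δ : Set ℝ)
    (M : ℝ → SignedMeasure Phase) : Prop where
  isFamily : IsFamily V Δ M
  hasDerivAt : ∀ h ∈ 𝒯, ∀ t ∈ Δ,
    HasDerivAt (fun s => ∫ᵛ z, h z ∂<•(M s))
      (∫ᵛ z, fderiv ℝ h z (fieldA z + fieldBConv V (M t) z) ∂<•(M t)) t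

end Vlasov

end

open Filter Topology
open scoped BoundedContinuousFunction

noncomputable section

namespace Vlasov

/-! Existence. The characteristics solve `x' = 2v`, `v' = ∫ ∇V(x_t(z) - x_t(w)) dμ⁰(w)`, an
autonomous system for the whole flow `Φ_t` with Lipschitz force. After subtracting the free flow,
the displacement weighted by `exp (-l|t|)` is a bounded function, and for large `l` the Picard map
is a contraction on all of `ℝ × ℝ⁶` (`contractingWith_picardMap`). The push-forward of `μ⁰` under
`Φ_t` is a weak solution by the chain rule; Schwartz decay beats the linear growth of the field, and
the total mass does not increase.

Uniqueness. Two solutions are compared in a dual norm, without the flow of a general solution. The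
tests are compactly supported `C¹` functions with `|φ| ≤ 1` and `(1 + η|z|)|Dφ(z)| ≤ 1`, where `0 <
η ≤ 1`. Three facts carry the estimate. (1) Over a short time `τ` a solution is transported by one
Euler step of its own field, with error at most `ε|τ|` on the whole class (`exists_step_le`). The
weight is needed here, because the field grows linearly and the force is uniformly continuous in
time only locally in space. (2) Composition with an Euler step preserves the class up to a factor `1
+ κ|τ|` (`PairingLE.comp_euler`). (3) The difference of the forces is at most `k` times a bound on
the dual norms that holds for all `η`, with `k` independent of `η`
(`exists_gradConv_sub_le_of_pairingLE`). As `∇V` has no compact support, it is cut off at scale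
`1/η` and `η` tends to `0`.

The admissible step size in (1) depends on `η`, while (3) needs every `η` at once, so a single
Gronwall argument does not close. Instead a bound `K exp (l|t|)` valid for all `η` is fed into the
force term, and for each fixed `η` a discrete Gronwall argument improves it to `(K/2) exp (l|t|)`
(`pairingLE_half`). Iteration gives `0`. -/

section

/-! ### Integration against signed measures. -/

section SignedMeasure

variable {X : Type*} [MeasurableSpace X] (μ : SignedMeasure X)
  {E : Type*} [NormedAddCommGroup E] [NormedSpace ℝ E]
  {F : Type*} [NormedAddCommGroup F] [NormedSpace ℝ F]

instance isFiniteMeasure_variation : IsFiniteMeasure μ.variation := by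
  rw [← SignedMeasure.totalVariation_eq_variation]
  unfold SignedMeasure.totalVariation
  infer_instance

lemma variation_eq_posPart_add_negPart :
    μ.variation = μ.toJordanDecomposition.posPart + μ.toJordanDecomposition.negPart := by
  rw [← SignedMeasure.totalVariation_eq_variation]
  rfl

variable {μ}

lemma integrable_posPart {G : Type*} [NormedAddCommGroup G] {f : X → G} (hf : Integrable f μ.variation) :
    Integrable f μ.toJordanDecomposition.posPart := by
  rw [variation_eq_posPart_add_negPart] at hf
  exact hf.left_of_add_measure

lemma integrable_negPart {G : Type*} [NormedAddCommGroup G] {f : X → G} (hf : Integrable f μ.variation) :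
    Integrable f μ.toJordanDecomposition.negPart := by
  rw [variation_eq_posPart_add_negPart] at hf
  exact hf.right_of_add_measure

/-- The Jordan decomposition transfers theorems on finite positive measures, such as differentiation
under the integral, to signed ones. -/
lemma integral_eq_posPart_sub_negPart {f : X → E} (hf : Integrable f μ.variation) :
    ∫ᵛ x, f x ∂<•μ = ∫ x, f x ∂μ.toJordanDecomposition.posPart
      - ∫ x, f x ∂μ.toJordanDecomposition.negPart := by
  conv_lhs => rw [← μ.toSignedMeasure_toJordanDecomposition]
  unfold JordanDecomposition.toSignedMeasure
  rw [VectorMeasure.integral_sub_vectorMeasure, VectorMeasure.integral_toSignedMeasure,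
    VectorMeasure.integral_toSignedMeasure]
  · simpa [VectorMeasure.Integrable] using integrable_posPart hf
  · simpa [VectorMeasure.Integrable] using integrable_negPart hf

lemma norm_integral_le_mul_variation {f : X → E} {C : ℝ} (h : ∀ x, ‖f x‖ ≤ C) (hC : 0 ≤ C) :
    ‖∫ᵛ x, f x ∂<•μ‖ ≤ C * μ.variation.real univ := by
  refine (VectorMeasure.norm_integral_le_of_norm_le_const (C := C) (ae_of_all _ h)).trans ?_
  have h1 : ‖(ContinuousLinearMap.lsmul ℝ ℝ (E := E)).flip‖ ≤ 1 := by
    rw [ContinuousLinearMap.opNorm_flip]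
    exact ContinuousLinearMap.opNorm_lsmul_le
  have := mul_le_mul_of_nonneg_left h1 hC
  nlinarith [measureReal_nonneg (μ := μ.variation) (s := univ)]

lemma integral_clm_comp [CompleteSpace E] [CompleteSpace F] (L : E →L[ℝ] F) {f : X → E}
    (hf : Integrable f μ.variation) :
    ∫ᵛ x, L (f x) ∂<•μ = L (∫ᵛ x, f x ∂<•μ) := by
  rw [integral_eq_posPart_sub_negPart hf, integral_eq_posPart_sub_negPart (L.integrable_comp hf),
    map_sub, L.integral_comp_comm (integrable_posPart hf),
    L.integral_comp_comm (integrable_negPart hf)]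

lemma integrable_of_norm_le {G : Type*} [NormedAddCommGroup G] [TopologicalSpace X]
    [OpensMeasurableSpace X] [SecondCountableTopologyEither X G] {f : X → G} (hf : Continuous f)
    {C : ℝ} (h : ∀ x, ‖f x‖ ≤ C) : Integrable f μ.variation :=
  Integrable.of_bound hf.aestronglyMeasurable C (ae_of_all _ h)

lemma hasDerivAt_integral {f f' : ℝ → X → E} {t : ℝ} {s : Set ℝ} (hs : s ∈ 𝓝 t) {C : ℝ}
    (hf : ∀ r, Integrable (f r) μ.variation)
    (hf' : AEStronglyMeasurable (f' t) μ.variation)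
    (hC : ∀ x, ∀ r ∈ s, ‖f' r x‖ ≤ C)
    (hd : ∀ x, ∀ r ∈ s, HasDerivAt (fun r => f r x) (f' r x) r) :
    HasDerivAt (fun r => ∫ᵛ x, f r x ∂<•μ) (∫ᵛ x, f' t x ∂<•μ) t := by
  have hi : Integrable (f' t) μ.variation :=
    Integrable.of_bound hf' C (ae_of_all _ fun x => hC x t (mem_of_mem_nhds hs))
  simp_rw [fun r => integral_eq_posPart_sub_negPart (hf r), integral_eq_posPart_sub_negPart hi]
  refine HasDerivAt.sub ?_ ?_
  · exact (hasDerivAt_integral_of_dominated_loc_of_deriv_le (bound := fun _ => C) hs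
      (Eventually.of_forall fun r => (integrable_posPart (hf r)).1) (integrable_posPart (hf t))
      (integrable_posPart hi).1 (ae_of_all _ hC) (integrable_const C) (ae_of_all _ hd)).2
  · exact (hasDerivAt_integral_of_dominated_loc_of_deriv_le (bound := fun _ => C) hs
      (Eventually.of_forall fun r => (integrable_negPart (hf r)).1) (integrable_negPart (hf t))
      (integrable_negPart hi).1 (ae_of_all _ hC) (integrable_const C) (ae_of_all _ hd)).2

lemma hasFDerivAt_integral {f : F → X → E} {f' : F → X → F →L[ℝ] E} {y : F} {C : ℝ}
    (hf : ∀ r, Integrable (f r) μ.variation)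
    (hf' : AEStronglyMeasurable (f' y) μ.variation)
    (hC : ∀ x r, ‖f' r x‖ ≤ C)
    (hd : ∀ x r, HasFDerivAt (fun r => f r x) (f' r x) r) :
    HasFDerivAt (fun r => ∫ᵛ x, f r x ∂<•μ) (∫ᵛ x, f' y x ∂<•μ) y := by
  have hi : Integrable (f' y) μ.variation :=
    Integrable.of_bound hf' C (ae_of_all _ fun x => hC x y)
  simp_rw [fun r => integral_eq_posPart_sub_negPart (hf r), integral_eq_posPart_sub_negPart hi]
  refine HasFDerivAt.sub ?_ ?_
  · exact hasFDerivAt_integral_of_dominated_of_fderiv_le (bound := fun _ => C) univ_mem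
      (Eventually.of_forall fun r => (integrable_posPart (hf r)).1) (integrable_posPart (hf y))
      (integrable_posPart hi).1 (ae_of_all _ fun x r _ => hC x r) (integrable_const C)
      (ae_of_all _ fun x r _ => hd x r)
  · exact hasFDerivAt_integral_of_dominated_of_fderiv_le (bound := fun _ => C) univ_mem
      (Eventually.of_forall fun r => (integrable_negPart (hf r)).1) (integrable_negPart (hf y))
      (integrable_negPart hi).1 (ae_of_all _ fun x r _ => hC x r) (integrable_const C)
      (ae_of_all _ fun x r _ => hd x r)

/-- Moving the negative parts to the opposite sides gives an equation between positive measures,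
which are determined by compactly supported continuous functions. -/
lemma eq_of_integral_eq_on_compactlySupported {μ ν : SignedMeasure Phase}
    (h : ∀ f : Phase → ℝ, Continuous f → HasCompactSupport f →
      ∫ᵛ x, f x ∂<•μ = ∫ᵛ x, f x ∂<•ν) : μ = ν := by
  have key : μ.toJordanDecomposition.posPart + ν.toJordanDecomposition.negPart
      = ν.toJordanDecomposition.posPart + μ.toJordanDecomposition.negPart := by
    refine Measure.ext_of_integral_eq_on_compactlySupported fun f => ?_
    have hi : ∀ (m : Measure Phase) [IsFiniteMeasure m], Integrable f m := fun m _ =>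
      f.continuous.integrable_of_hasCompactSupport f.hasCompactSupport
    have := h f f.continuous f.hasCompactSupport
    rw [integral_eq_posPart_sub_negPart (hi _), integral_eq_posPart_sub_negPart (hi _)] at this
    rw [integral_add_measure (hi _) (hi _), integral_add_measure (hi _) (hi _)]
    linarith
  ext s hs
  rw [SignedMeasure.apply_eq_posPart_real_sub_negPart_real _ hs,
    SignedMeasure.apply_eq_posPart_real_sub_negPart_real _ hs]
  have := congrArg (fun m : Measure Phase => m.real s) key
  beta_reduce at this
  rw [measureReal_add_apply, measureReal_add_apply] at this
  linarith

/-- If the variation exceeds `2C`, some measurable set has `|μ|`-value above `C` in modulus: the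
larger of the positive and negative parts carries at least half of the mass. -/
lemma variation_real_univ_le {μ : SignedMeasure Phase} {C : ℝ≥0} (h : supNorm μ ≤ C) :
    μ.variation.real univ ≤ 2 * C := by
  have : μ.variation univ ≤ 2 * C := by
    by_contra! hlt
    obtain ⟨t, -, ht, hlt'⟩ :=
      SignedMeasure.exists_subset_lt_enorm_apply_of_lt_variation μ MeasurableSet.univ hlt
    have h1 : ‖μ t‖ₑ ≤ C := (le_iSup₂ (f := fun B (_ : MeasurableSet B) => ‖μ B‖ₑ) t ht).trans h
    exact absurd hlt' (not_lt.2 (mul_le_mul_right h1 2))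
  rw [measureReal_def]
  exact (ENNReal.toReal_mono (by finiteness) this).trans_eq (by simp)

lemma supNorm_le_variation (μ : SignedMeasure Phase) : supNorm μ ≤ μ.variation univ :=
  iSup₂_le fun B _ => (μ.enorm_measure_le_variation B).trans (measure_mono (subset_univ B))

end SignedMeasure

end

/-! ### Regularity and growth of the force field. -/

section

/-- `g` is continuously differentiable, and `g` and its derivative are bounded by `C`. -/
structure IsC1b {E F : Type*} [NormedAddCommGroup E] [NormedSpace ℝ E] [NormedAddCommGroup F]
    [NormedSpace ℝ F] (g : E → F) (C : ℝ) : Prop where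
  contDiff : ContDiff ℝ 1 g
  norm_le : ∀ x, ‖g x‖ ≤ C
  norm_fderiv_le : ∀ x, ‖fderiv ℝ g x‖ ≤ C

namespace IsC1b

variable {E F : Type*} [NormedAddCommGroup E] [NormedSpace ℝ E] [NormedAddCommGroup F]
  [NormedSpace ℝ F] {g : E → F} {C : ℝ}

lemma nonneg (hg : IsC1b g C) : 0 ≤ C := (norm_nonneg _).trans (hg.norm_le 0)

lemma differentiable (hg : IsC1b g C) : Differentiable ℝ g := hg.contDiff.differentiable one_ne_zero

lemma continuous (hg : IsC1b g C) : Continuous g := hg.contDiff.continuous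

lemma continuous_fderiv (hg : IsC1b g C) : Continuous (fderiv ℝ g) :=
  hg.contDiff.continuous_fderiv one_ne_zero

lemma norm_sub_le (hg : IsC1b g C) (x y : E) : ‖g x - g y‖ ≤ C * ‖x - y‖ :=
  convex_univ.norm_image_sub_le_of_norm_fderiv_le (fun x _ => hg.differentiable x)
    (fun x _ => hg.norm_fderiv_le x) (mem_univ y) (mem_univ x)

end IsC1b

lemma IsC2b.exists_isC1b_gradient {V : R3 → ℝ} (hV : IsC2b V) : ∃ C, IsC1b (∇ V) C := by
  obtain ⟨hc, hb⟩ := hV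
  obtain ⟨C₁, h₁⟩ := hb 1 (by norm_num)
  obtain ⟨C₂, h₂⟩ := hb 2 le_rfl
  have e : ∇ V = (InnerProductSpace.toDual ℝ R3).symm ∘ fderiv ℝ V := rfl
  refine ⟨max C₁ C₂, ?_, fun x => ?_, fun x => ?_⟩
  · rw [e]
    exact (InnerProductSpace.toDual ℝ R3).symm.contDiff.comp
      (hc.fderiv_right (m := 1) (by norm_num))
  · refine le_max_of_le_left ?_
    rw [e, Function.comp_apply, LinearIsometryEquiv.norm_map, ← norm_iteratedFDeriv_one]
    exact h₁ x
  · refine le_max_of_le_right ((le_of_eq ?_).trans (h₂ x))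
    rw [← norm_iteratedFDeriv_one, e,
      LinearIsometryEquiv.norm_iteratedFDeriv_comp_left,
      norm_iteratedFDeriv_fderiv]

variable {V : R3 → ℝ} {C : ℝ}

lemma integrable_gradient_sub (hg : IsC1b (∇ V) C) (μ : SignedMeasure Phase) (x : R3) :
    Integrable (fun w : Phase => ∇ V (x - w.1)) μ.variation :=
  integrable_of_norm_le (hg.continuous.comp (by fun_prop)) fun _ => hg.norm_le _

lemma norm_gradConv_le (hg : IsC1b (∇ V) C) (μ : SignedMeasure Phase) (x : R3) :
    ‖gradConv V μ x‖ ≤ C * μ.variation.real univ :=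
  norm_integral_le_mul_variation (fun _ => hg.norm_le _) hg.nonneg

lemma hasFDerivAt_gradConv (hg : IsC1b (∇ V) C) (μ : SignedMeasure Phase) (x : R3) :
    HasFDerivAt (gradConv V μ) (∫ᵛ w, fderiv ℝ (∇ V) (x - w.1) ∂<•μ) x := by
  refine hasFDerivAt_integral (C := C) (f := fun x w => ∇ V (x - w.1))
    (f' := fun x (w : Phase) => fderiv ℝ (∇ V) (x - w.1)) (integrable_gradient_sub hg μ) ?_
    (fun w x => hg.norm_fderiv_le _) fun w x => ?_
  · exact (hg.continuous_fderiv.comp (by fun_prop)).aestronglyMeasurable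
  · exact (hg.differentiable _).hasFDerivAt.comp x ((hasFDerivAt_id x).sub_const w.1)

lemma isC1b_gradConv (hg : IsC1b (∇ V) C) (μ : SignedMeasure Phase) :
    IsC1b (gradConv V μ) (C * μ.variation.real univ) where
  contDiff := by
    refine contDiff_one_iff_fderiv.2
      ⟨fun x => (hasFDerivAt_gradConv hg μ x).differentiableAt, ?_⟩
    rw [funext fun x => (hasFDerivAt_gradConv hg μ x).fderiv]
    exact VectorMeasure.continuous_of_dominated (bound := fun _ => C)
      (fun x => (hg.continuous_fderiv.comp (by fun_prop)).aestronglyMeasurable)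
      (fun x => ae_of_all _ fun w => hg.norm_fderiv_le _) (integrable_const C)
      (ae_of_all _ fun w => hg.continuous_fderiv.comp (by fun_prop))
  norm_le := norm_gradConv_le hg μ
  norm_fderiv_le x := by
    rw [(hasFDerivAt_gradConv hg μ x).fderiv]
    exact norm_integral_le_mul_variation (fun w => hg.norm_fderiv_le _) hg.nonneg

lemma fieldBConv_eq (hg : IsC1b (∇ V) C) (μ : SignedMeasure Phase) (z : Phase) :
    fieldBConv V μ z = (0, gradConv V μ z.1) :=
  integral_clm_comp (ContinuousLinearMap.inr ℝ R3 R3) (integrable_gradient_sub hg μ z.1)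

/-- The velocity field `A + B_μ` of the characteristics. -/
def field (V : R3 → ℝ) (μ : SignedMeasure Phase) (z : Phase) : Phase :=
  ((2 : ℝ) • z.2, gradConv V μ z.1)

lemma fieldA_add_fieldBConv (hg : IsC1b (∇ V) C) (μ : SignedMeasure Phase) (z : Phase) :
    fieldA z + fieldBConv V μ z = field V μ z := by
  rw [fieldBConv_eq hg, fieldA, field, Prod.mk_add_mk, add_zero, zero_add]

lemma contDiff_field (hg : IsC1b (∇ V) C) (μ : SignedMeasure Phase) :
    ContDiff ℝ 1 (field V μ) :=
  (contDiff_snd.const_smul (2 : ℝ)).prodMk ((isC1b_gradConv hg μ).contDiff.comp contDiff_fst)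

lemma norm_field_le {μ : SignedMeasure Phase} {m : ℝ}
    (hm : ∀ x, ‖gradConv V μ x‖ ≤ m) (z : Phase) : ‖field V μ z‖ ≤ 2 * ‖z‖ + m := by
  have h0 : 0 ≤ m := (norm_nonneg _).trans (hm 0)
  refine max_le ?_ ((hm z.1).trans (by linarith [norm_nonneg z]))
  change ‖(2 : ℝ) • z.2‖ ≤ _
  rw [norm_smul, Real.norm_two]
  linarith [norm_snd_le z]

lemma fderiv_field_apply (hg : IsC1b (∇ V) C) (μ : SignedMeasure Phase) (z w : Phase) :
    fderiv ℝ (field V μ) z w = ((2 : ℝ) • w.2, fderiv ℝ (gradConv V μ) z.1 w.1) := by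
  have h1 : HasFDerivAt (fun z : Phase => (2 : ℝ) • z.2)
      ((2 : ℝ) • ContinuousLinearMap.snd ℝ R3 R3) z := hasFDerivAt_snd.fun_const_smul 2
  have h2 : HasFDerivAt (fun z : Phase => gradConv V μ z.1) _ z :=
    ((isC1b_gradConv hg μ).differentiable z.1).hasFDerivAt.comp z hasFDerivAt_fst
  rw [show field V μ = fun z => ((2 : ℝ) • z.2, gradConv V μ z.1) from rfl,
    (h1.prodMk h2).fderiv]
  rfl

end

/-! ### Mollification and the extension to `C¹` test functions. -/

section

section Mollification

variable {H : Type*} [NormedAddCommGroup H] [NormedSpace ℝ H] [MeasurableSpace H] [BorelSpace H]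
  [FiniteDimensional ℝ H] {G : Type*} [NormedAddCommGroup G] [NormedSpace ℝ G] [CompleteSpace G]

lemma exists_forall_dist_normed_convolution_le (μ : Measure H) [μ.IsAddHaarMeasure] {f : H → G}
    (hf : Continuous f) (hc : HasCompactSupport f) {ε : ℝ} (hε : 0 < ε) :
    ∃ δ > 0, ∀ b : ContDiffBump (0 : H), b.rOut ≤ δ → ∀ x,
      dist (convolution (b.normed μ) f (ContinuousLinearMap.lsmul ℝ ℝ) μ x) (f x) ≤ ε := by
  obtain ⟨δ, hδ, h⟩ := Metric.uniformContinuous_iff.1 (hc.uniformContinuous_of_continuous hf) ε hε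
  refine ⟨δ, hδ, fun b hb x => b.dist_normed_convolution_le hf.aestronglyMeasurable ?_⟩
  exact fun y hy => (h ((Metric.mem_ball.1 hy).trans_le hb)).le

lemma exists_contDiffBump_rOut_le (H : Type*) [NormedAddCommGroup H] {δ : ℝ} (hδ : 0 < δ) :
    ∃ b : ContDiffBump (0 : H), b.rOut ≤ δ :=
  ⟨⟨δ / 2, δ, by positivity, by linarith⟩, le_rfl⟩

lemma exists_smooth_dist_le {f : H → ℝ} (hf : Continuous f) (hc : HasCompactSupport f) {ε : ℝ}
    (hε : 0 < ε) : ∃ ψ : H → ℝ, ContDiff ℝ ∞ ψ ∧ HasCompactSupport ψ ∧ ∀ x, |ψ x - f x| ≤ ε := by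
  obtain ⟨δ, hδ, h⟩ := exists_forall_dist_normed_convolution_le (Measure.addHaar (G := H)) hf hc hε
  obtain ⟨b, hb⟩ := exists_contDiffBump_rOut_le H hδ
  refine ⟨_, ?_, ?_, h b hb⟩
  · exact b.hasCompactSupport_normed.contDiff_convolution_left (n := ⊤) _ b.contDiff_normed
      hf.locallyIntegrable
  · exact b.hasCompactSupport_normed.convolution _ hc

/-- Convolution commutes with the derivative, so one bump function approximates both. The supports
stay in a fixed compact set, on which a field of linear growth is bounded. -/
lemma exists_smooth_fderiv_dist_le {f : H → ℝ} (hf : ContDiff ℝ 1 f) (hc : HasCompactSupport f)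
    {ε : ℝ} (hε : 0 < ε) : ∃ ψ : H → ℝ, ContDiff ℝ ∞ ψ ∧ HasCompactSupport ψ ∧
      tsupport ψ ⊆ Metric.cthickening 1 (tsupport f) ∧
      (∀ x, |ψ x - f x| ≤ ε) ∧ ∀ x, ‖fderiv ℝ ψ x - fderiv ℝ f x‖ ≤ ε := by
  set μ := Measure.addHaar (G := H)
  obtain ⟨δ₁, hδ₁, h₁⟩ := exists_forall_dist_normed_convolution_le μ hf.continuous hc hε
  obtain ⟨δ₂, hδ₂, h₂⟩ := exists_forall_dist_normed_convolution_le μ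
    (hf.continuous_fderiv one_ne_zero) (hc.fderiv ℝ) hε
  obtain ⟨b, hb⟩ := exists_contDiffBump_rOut_le H (δ := min 1 (min δ₁ δ₂)) (by positivity)
  refine ⟨convolution (b.normed μ) f (ContinuousLinearMap.lsmul ℝ ℝ) μ, ?_, ?_, ?_, ?_, ?_⟩
  · exact b.hasCompactSupport_normed.contDiff_convolution_left (n := ⊤) _ b.contDiff_normed
      hf.continuous.locallyIntegrable
  · exact b.hasCompactSupport_normed.convolution _ hc
  · refine closure_minimal ?_ Metric.isClosed_cthickening
    refine (support_convolution_subset_swap _).trans ?_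
    rintro _ ⟨x, hx, y, hy, rfl⟩
    rw [b.support_normed_eq] at hy
    refine Metric.mem_cthickening_of_dist_le _ x _ _ (subset_tsupport f hx) ?_
    have : ‖y‖ < b.rOut := by simpa using hy
    simpa using (this.le.trans hb).trans (min_le_left _ _)
  · exact h₁ b (hb.trans ((min_le_right _ _).trans (min_le_left _ _)))
  · intro x
    have e := hc.hasFDerivAt_convolution_right (ContinuousLinearMap.lsmul ℝ ℝ) (μ := μ)
      (f := b.normed μ) b.continuous_normed.locallyIntegrable hf x
    have e' : ContinuousLinearMap.precompR H (ContinuousLinearMap.lsmul ℝ ℝ (E := ℝ)) =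
        ContinuousLinearMap.lsmul ℝ ℝ := by
      ext c L
      simp [ContinuousLinearMap.precompR_apply]
    rw [e.fderiv, e', ← dist_eq_norm]
    exact h₂ b (hb.trans ((min_le_right _ _).trans (min_le_right _ _))) x

end Mollification

/-- `M` solves the Vlasov equation weakly on the open set `Δ` against the compactly supported
smooth functions, with variation bounded on compact subintervals. -/
structure IsCompactlyWeakSolution (V : R3 → ℝ) (Δ : Set ℝ) (M : ℝ → SignedMeasure Phase) :
    Prop where
  isOpen : IsOpen Δ
  bounded : ∀ a b, Icc a b ⊆ Δ → ∃ m : ℝ, ∀ t ∈ Icc a b, (M t).variation.real univ ≤ m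
  continuous : ∀ x : R3, ContinuousOn (fun t => gradConv V (M t) x) Δ
  hasDerivAt : ∀ h : Phase → ℝ, ContDiff ℝ ∞ h → HasCompactSupport h → ∀ t ∈ Δ,
    HasDerivAt (fun s => ∫ᵛ z, h z ∂<•(M s)) (∫ᵛ z, fderiv ℝ h z (field V (M t) z) ∂<•(M t)) t

variable {V : R3 → ℝ} {C : ℝ} {Δ : Set ℝ} {M : ℝ → SignedMeasure Phase}

lemma IsWeakSolution.isCompactlyWeakSolution (hg : IsC1b (∇ V) C) (hΔ : IsOpen Δ)
    (h : IsWeakSolution compactTests V Δ M) : IsCompactlyWeakSolution V Δ M where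
  isOpen := hΔ
  bounded a b hab := by
    obtain ⟨m, hm⟩ := h.isFamily.bounded (Icc a b) hab ordConnected_Icc (Metric.isBounded_Icc a b)
    refine ⟨2 * m, fun t ht => variation_real_univ_le ?_⟩
    exact (le_iSup₂ (f := fun t (_ : t ∈ Icc a b) => supNorm (M t)) t ht).trans hm.le
  continuous := h.isFamily.continuous
  hasDerivAt φ hφ hc t ht := by
    simpa only [fieldA_add_fieldBConv hg] using h.hasDerivAt φ ⟨hφ, hc⟩ t ht

lemma exists_Icc_mem_nhds {t : ℝ} (hΔ : IsOpen Δ) (ht : t ∈ Δ) :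
    ∃ a b, Icc a b ⊆ Δ ∧ t ∈ Ioo a b := by
  obtain ⟨ε, hε, h⟩ := Metric.isOpen_iff.1 hΔ t ht
  refine ⟨t - ε / 2, t + ε / 2, ?_, ⟨by linarith, by linarith⟩⟩
  rw [← Real.closedBall_eq_Icc]
  exact (Metric.closedBall_subset_ball (by linarith)).trans h

lemma hasCompactSupport_fderiv_apply {φ : Phase → ℝ} (hc : HasCompactSupport φ)
    (v : Phase → Phase) : HasCompactSupport fun z => fderiv ℝ φ z (v z) :=
  (hc.fderiv ℝ).mono fun z hz h0 => hz (by simp [h0])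

lemma continuous_fderiv_apply {φ : Phase → ℝ} (hφ : ContDiff ℝ 1 φ) {v : Phase → Phase}
    (hv : Continuous v) : Continuous fun z => fderiv ℝ φ z (v z) :=
  (hφ.continuous_fderiv one_ne_zero).clm_apply hv

lemma integrable_of_hasCompactSupport {μ : SignedMeasure Phase} {φ : Phase → ℝ}
    (hφ : Continuous φ) (hc : HasCompactSupport φ) : Integrable φ μ.variation :=
  hφ.integrable_of_hasCompactSupport hc

/-- Needed because `∇V * μ` is only `C¹`, so tests composed with Euler steps are only `C¹`.
Mollified tests give time derivatives converging uniformly near `t`, which suffices to pass to the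
limit; continuity of these derivatives in time is not required. -/
lemma IsCompactlyWeakSolution.hasDerivAt_of_contDiff_one (hg : IsC1b (∇ V) C)
    (h : IsCompactlyWeakSolution V Δ M) {φ : Phase → ℝ} (hφ : ContDiff ℝ 1 φ)
    (hc : HasCompactSupport φ) {t : ℝ} (ht : t ∈ Δ) :
    HasDerivAt (fun s => ∫ᵛ z, φ z ∂<•(M s))
      (∫ᵛ z, fderiv ℝ φ z (field V (M t) z) ∂<•(M t)) t := by
  obtain ⟨a, b, hab, htab⟩ := exists_Icc_mem_nhds h.isOpen ht
  obtain ⟨m, hm⟩ := h.bounded a b hab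
  have hm0 : 0 ≤ m := measureReal_nonneg.trans (hm t ⟨htab.1.le, htab.2.le⟩)
  choose ψ hψs hψc hψt hψ hψ' using fun n : ℕ =>
    exists_smooth_fderiv_dist_le hφ hc (Nat.one_div_pos_of_nat (α := ℝ) (n := n))
  obtain ⟨R, hR0, hR⟩ := (hc.isCompact.cthickening (r := 1)).isBounded.exists_pos_norm_le
  have hlim : Tendsto (fun n : ℕ => 1 / ((n : ℝ) + 1)) atTop (𝓝 0) :=
    tendsto_one_div_add_atTop_nhds_zero_nat
  have hIoo : Ioo a b ⊆ Icc a b := Ioo_subset_Icc_self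
  refine hasDerivAt_of_tendstoUniformlyOn (l := atTop) (s := Ioo a b) isOpen_Ioo
    (f := fun n s => ∫ᵛ z, ψ n z ∂<•(M s))
    (f' := fun n s => ∫ᵛ z, fderiv ℝ (ψ n) z (field V (M s) z) ∂<•(M s))
    (g' := fun s => ∫ᵛ z, fderiv ℝ φ z (field V (M s) z) ∂<•(M s)) ?_
    (Eventually.of_forall fun n s hs => h.hasDerivAt _ (hψs n) (hψc n) s (hab (hIoo hs)))
    (fun s hs => ?_) htab
  · rw [Metric.tendstoUniformlyOn_iff]
    intro ε hε
    have : Tendsto (fun n : ℕ => 1 / ((n : ℝ) + 1) * (2 * R + C * m) * m) atTop (𝓝 0) := by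
      simpa using (hlim.mul_const (2 * R + C * m)).mul_const m
    filter_upwards [this.eventually_lt_const hε] with n hn s hs
    refine lt_of_le_of_lt ?_ hn
    have hi : ∀ {χ : Phase → ℝ}, ContDiff ℝ 1 χ → HasCompactSupport χ →
        Integrable (fun z => fderiv ℝ χ z (field V (M s) z)) (M s).variation := fun h1 h2 =>
      integrable_of_hasCompactSupport
        (continuous_fderiv_apply h1 (contDiff_field hg (M s)).continuous)
        (hasCompactSupport_fderiv_apply h2 _)
    rw [dist_comm, dist_eq_norm, ← VectorMeasure.integral_sub
      (hi ((hψs n).of_le (by norm_num)) (hψc n)) (hi hφ hc)]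
    have hpos : 0 ≤ 1 / ((n : ℝ) + 1) * (2 * R + C * m) := by
      have := hg.nonneg; positivity
    refine (norm_integral_le_mul_variation (C := 1 / ((n : ℝ) + 1) * (2 * R + C * m))
      (fun z => ?_) hpos).trans (mul_le_mul_of_nonneg_left (hm s (hIoo hs)) hpos)
    by_cases hz : z ∈ Metric.cthickening 1 (tsupport φ)
    · have hF : ‖field V (M s) z‖ ≤ 2 * R + C * m := by
        refine (norm_field_le (m := C * m) (fun x => ?_) z).trans (by linarith [hR z hz])
        exact (norm_gradConv_le hg _ x).trans
          (mul_le_mul_of_nonneg_left (hm s (hIoo hs)) hg.nonneg)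
      have := (fderiv ℝ (ψ n) z - fderiv ℝ φ z).le_of_opNorm_le_of_le (hψ' n z) hF
      simpa using this
    · have h1 : fderiv ℝ (ψ n) z = 0 :=
        image_eq_zero_of_notMem_tsupport fun hz' => hz (hψt n (tsupport_fderiv_subset ℝ hz'))
      have h2 : fderiv ℝ φ z = 0 := image_eq_zero_of_notMem_tsupport fun hz' =>
        hz (Metric.self_subset_cthickening _ (tsupport_fderiv_subset ℝ hz'))
      simpa [h1, h2] using hpos
  · rw [tendsto_iff_dist_tendsto_zero]
    refine squeeze_zero (fun _ => dist_nonneg) (fun n => ?_)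
      (show Tendsto (fun n : ℕ => 1 / ((n : ℝ) + 1) * m) atTop (𝓝 0) by
        simpa using hlim.mul_const m)
    rw [dist_eq_norm, ← VectorMeasure.integral_sub
      (integrable_of_hasCompactSupport (hψs n).continuous (hψc n))
      (integrable_of_hasCompactSupport hφ.continuous hc)]
    have hpos : (0 : ℝ) ≤ 1 / ((n : ℝ) + 1) := by positivity
    exact (norm_integral_le_mul_variation (hψ n) hpos).trans
      (mul_le_mul_of_nonneg_left (hm s (hIoo hs)) hpos)

/-- The locally bounded variation makes the pairing a locally uniform limit of pairings with smooth
tests, which are differentiable. -/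
lemma IsCompactlyWeakSolution.continuousAt_integral (h : IsCompactlyWeakSolution V Δ M)
    {w : Phase → ℝ} (hw : Continuous w) (hc : HasCompactSupport w) {t : ℝ} (ht : t ∈ Δ) :
    ContinuousAt (fun s => ∫ᵛ z, w z ∂<•(M s)) t := by
  obtain ⟨a, b, hab, htab⟩ := exists_Icc_mem_nhds h.isOpen ht
  obtain ⟨m, hm⟩ := h.bounded a b hab
  have hm0 : 0 ≤ m := measureReal_nonneg.trans (hm t ⟨htab.1.le, htab.2.le⟩)
  refine continuousAt_of_locally_uniform_approx_of_continuousAt fun u hu => ?_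
  obtain ⟨ε, hε, hu⟩ := Metric.mem_uniformity_dist.1 hu
  obtain ⟨ψ, hψs, hψc, hψ⟩ := exists_smooth_dist_le hw hc (ε := ε / (m + 1)) (by positivity)
  refine ⟨Ioo a b, Ioo_mem_nhds htab.1 htab.2, fun s => ∫ᵛ z, ψ z ∂<•(M s),
    (h.hasDerivAt ψ hψs hψc t ht).continuousAt, fun s hs => hu ?_⟩
  rw [dist_comm, dist_eq_norm, ← VectorMeasure.integral_sub
      (integrable_of_hasCompactSupport hψs.continuous hψc)
      (integrable_of_hasCompactSupport hw hc)]
  have hpos : 0 ≤ ε / (m + 1) := by positivity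
  refine (norm_integral_le_mul_variation hψ hpos).trans_lt ?_
  refine (mul_le_mul_of_nonneg_left (hm s (Ioo_subset_Icc_self hs)) hpos).trans_lt ?_
  rw [div_mul_eq_mul_div, div_lt_iff₀ (by positivity)]
  nlinarith

end

/-! ### Time-dependent tests and Euler steps. -/

section

variable {V : R3 → ℝ} {C : ℝ} {Δ : Set ℝ} {M : ℝ → SignedMeasure Phase}

/-- The product rule for the pairing of a weak solution with a time-dependent test function. -/
lemma IsCompactlyWeakSolution.hasDerivAt_integral_time_dependent (hg : IsC1b (∇ V) C)
    (h : IsCompactlyWeakSolution V Δ M) {u : ℝ → Phase → ℝ} {w : Phase → ℝ} {r : ℝ} (hr : r ∈ Δ)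
    (hu : ∀ s, ContDiff ℝ 1 (u s)) (huc : ∀ᶠ s in 𝓝 r, HasCompactSupport (u s))
    (hw : Continuous w) (hwc : HasCompactSupport w)
    (hd : ∀ ε > 0, ∀ᶠ s in 𝓝 r, ∀ z, |u s z - u r z - (s - r) * w z| ≤ ε * |s - r|) :
    HasDerivAt (fun s => ∫ᵛ z, u s z ∂<•(M s))
      (∫ᵛ z, (fderiv ℝ (u r) z (field V (M r) z) + w z) ∂<•(M r)) r := by
  have hur := huc.self_of_nhds
  have hi : ∀ s, Integrable w (M s).variation := fun s => integrable_of_hasCompactSupport hw hwc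
  have hir : ∀ s, Integrable (u r) (M s).variation := fun s =>
    integrable_of_hasCompactSupport (hu r).continuous hur
  rw [VectorMeasure.integral_fun_add (integrable_of_hasCompactSupport
      (continuous_fderiv_apply (hu r) (contDiff_field hg (M r)).continuous)
      (hasCompactSupport_fderiv_apply hur _)) (hi r)]
  -- The increment splits into three `o(s - r)` errors: the measure moving against the frozen test
  -- `u r`, the replacement of `M r` by `M s` in the pairing with `w`, and the remainder of `u` in
  -- time.
  have h1 := (h.hasDerivAt_of_contDiff_one hg (hu r) hur hr).isLittleO
  have h2 := h.continuousAt_integral hw hwc hr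
  obtain ⟨a, b, hab, hrab⟩ := exists_Icc_mem_nhds h.isOpen hr
  obtain ⟨m, hm⟩ := h.bounded a b hab
  have hm0 : 0 ≤ m := measureReal_nonneg.trans (hm r ⟨hrab.1.le, hrab.2.le⟩)
  have h3 : (fun s => (s - r) * (∫ᵛ z, w z ∂<•(M s) - ∫ᵛ z, w z ∂<•(M r)))
      =o[𝓝 r] fun s => s - r := by
    have : (fun s => ∫ᵛ z, w z ∂<•(M s) - ∫ᵛ z, w z ∂<•(M r)) =o[𝓝 r] fun _ => (1 : ℝ) :=
      (Asymptotics.isLittleO_one_iff ℝ).2 (tendsto_sub_nhds_zero_iff.2 h2)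
    simpa using (Asymptotics.isBigO_refl (fun s => s - r) (𝓝 r)).mul_isLittleO this
  have h4 : (fun s => ∫ᵛ z, (u s z - u r z - (s - r) * w z) ∂<•(M s)) =o[𝓝 r]
      fun s => s - r := by
    refine Asymptotics.isLittleO_iff.2 fun ε hε => ?_
    filter_upwards [hd (ε / (m + 1)) (by positivity), Icc_mem_nhds hrab.1 hrab.2] with s hs hsab
    refine (norm_integral_le_mul_variation hs (by positivity)).trans ?_
    refine (mul_le_mul_of_nonneg_left (hm s hsab) (by positivity)).trans ?_
    rw [Real.norm_eq_abs, div_mul_eq_mul_div, div_mul_eq_mul_div, div_le_iff₀ (by positivity)]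
    nlinarith [mul_nonneg hε.le (abs_nonneg (s - r))]
  refine HasDerivAt.of_isLittleO (((h1.add h3).add h4).congr' ?_ EventuallyEq.rfl)
  filter_upwards [huc] with s hs
  have his : Integrable (u s) (M s).variation :=
    integrable_of_hasCompactSupport (hu s).continuous hs
  have hmul : ∫ᵛ z, (s - r) * w z ∂<•(M s) = (s - r) * ∫ᵛ z, w z ∂<•(M s) :=
    VectorMeasure.integral_fun_smul _ _ (s - r) w
  rw [VectorMeasure.integral_fun_sub (f := fun z => u s z - u r z) (his.sub (hir s))
    ((hi s).const_mul (s - r)), VectorMeasure.integral_fun_sub his (hir s), hmul]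
  simp only [smul_eq_mul]
  ring

/-- One explicit Euler step of length `τ` along the vector field `b`. -/
def euler (b : Phase → Phase) (τ : ℝ) (z : Phase) : Phase := z + τ • b z

section Euler

variable {b : Phase → Phase} {c : ℝ}

lemma contDiff_euler (hb : ContDiff ℝ 1 b) (τ : ℝ) : ContDiff ℝ 1 (euler b τ) :=
  contDiff_id.add (hb.const_smul τ)

/-- For `|τ| ≤ 1/4` the displacement is at most `‖z‖/2 + c/4` and is absorbed on the left. This
properness replaces invertibility of the Euler map. -/
lemma norm_le_norm_euler (hc : 0 ≤ c) (hbc : ∀ z, ‖b z‖ ≤ 2 * ‖z‖ + c) {τ : ℝ}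
    (hτ : |τ| ≤ 1 / 4) (z : Phase) : ‖z‖ ≤ 2 * ‖euler b τ z‖ + c := by
  have h1 : ‖z‖ ≤ ‖euler b τ z‖ + ‖τ • b z‖ := by
    simpa [euler] using norm_sub_le (z + τ • b z) (τ • b z)
  have h2 : ‖τ • b z‖ ≤ 1 / 4 * (2 * ‖z‖ + c) := by
    rw [norm_smul]
    exact mul_le_mul hτ (hbc z) (norm_nonneg _) (by norm_num)
  linarith

lemma eq_zero_of_euler {G : Type*} [Zero G] {φ : Phase → G} {R : ℝ}
    (hR : ∀ z ∈ tsupport φ, ‖z‖ ≤ R) (hc : 0 ≤ c) (hbc : ∀ z, ‖b z‖ ≤ 2 * ‖z‖ + c) {τ : ℝ}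
    (hτ : |τ| ≤ 1 / 4) {z : Phase} (hz : 2 * R + c < ‖z‖) : φ (euler b τ z) = 0 := by
  refine image_eq_zero_of_notMem_tsupport fun h => ?_
  linarith [hR _ h, norm_le_norm_euler hc hbc hτ z]

lemma hasCompactSupport_comp_euler {G : Type*} [Zero G] {φ : Phase → G}
    (hφ : HasCompactSupport φ) (hc : 0 ≤ c) (hbc : ∀ z, ‖b z‖ ≤ 2 * ‖z‖ + c) {τ : ℝ}
    (hτ : |τ| ≤ 1 / 4) : HasCompactSupport (fun z => φ (euler b τ z)) := by
  obtain ⟨R, -, hR⟩ := hφ.isCompact.isBounded.exists_pos_norm_le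
  refine HasCompactSupport.intro (isCompact_closedBall (0 : Phase) (2 * R + c)) fun z hz => ?_
  exact eq_zero_of_euler hR hc hbc hτ (by simpa using hz)

lemma fderiv_comp_euler (hb : ContDiff ℝ 1 b) {φ : Phase → ℝ} (hφ : ContDiff ℝ 1 φ) (τ : ℝ)
    (z v : Phase) : fderiv ℝ (fun z => φ (euler b τ z)) z v =
      fderiv ℝ φ (euler b τ z) (v + τ • fderiv ℝ b z v) := by
  have h1 : HasFDerivAt (euler b τ) (ContinuousLinearMap.id ℝ Phase + τ • fderiv ℝ b z) z :=
    (hasFDerivAt_id z).add (((hb.differentiable one_ne_zero) z).hasFDerivAt.const_smul τ)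
  have h2 := ((hφ.differentiable one_ne_zero) (euler b τ z)).hasFDerivAt.comp z h1
  rw [show (fun z => φ (euler b τ z)) = φ ∘ euler b τ from rfl, h2.fderiv]
  simp

/-- Far out everything vanishes by properness of the Euler map; on the remaining ball the field is
bounded and `Dφ` is uniformly continuous, so the mean value inequality in time is uniform in `z`. -/
lemma eventually_comp_euler_sub_le (hc : 0 ≤ c) (hbc : ∀ z, ‖b z‖ ≤ 2 * ‖z‖ + c)
    {φ : Phase → ℝ} (hφ : ContDiff ℝ 1 φ) (hφc : HasCompactSupport φ) {t r : ℝ}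
    (htr : |t - r| < 1 / 4) {ε : ℝ} (hε : 0 < ε) :
    ∀ᶠ s in 𝓝 r, ∀ z, |φ (euler b (t - s) z) - φ (euler b (t - r) z)
      - (s - r) * -(fderiv ℝ φ (euler b (t - r) z) (b z))| ≤ ε * |s - r| := by
  obtain ⟨R, hR0, hR⟩ := hφc.isCompact.isBounded.exists_pos_norm_le
  set B := 2 * (2 * R + c) + c
  have hB : 0 < B := by positivity
  have huc := (hφc.fderiv ℝ).uniformContinuous_of_continuous (hφ.continuous_fderiv one_ne_zero)
  obtain ⟨δ, hδ, hδ'⟩ := Metric.uniformContinuous_iff.1 huc (ε / B) (by positivity)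
  have hev : ∀ᶠ s in 𝓝 r, |t - s| < 1 / 4 :=
    (continuous_const.sub continuous_id).abs.continuousAt.eventually_lt continuousAt_const htr
  obtain ⟨ρ, hρ, hρ'⟩ := Metric.eventually_nhds_iff_ball.1 hev
  refine Metric.eventually_nhds_iff_ball.2 ⟨min ρ (δ / B), by positivity, fun s hs z => ?_⟩
  by_cases hz : 2 * R + c < ‖z‖
  · have hsρ := hρ' s (Metric.ball_subset_ball (min_le_left _ _) hs)
    have h0 : fderiv ℝ φ (euler b (t - r) z) = 0 :=
      eq_zero_of_euler (fun z hz => hR z (tsupport_fderiv_subset ℝ hz)) hc hbc htr.le hz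
    rw [eq_zero_of_euler hR hc hbc hsρ.le hz, eq_zero_of_euler hR hc hbc htr.le hz, h0]
    simpa using mul_nonneg hε.le (abs_nonneg _)
  push Not at hz
  have hbz : ‖b z‖ ≤ B := (hbc z).trans (by simp only [B]; linarith)
  set L := fderiv ℝ φ (euler b (t - r) z)
  -- The linear term is subtracted before the mean value inequality, so that the derivative to be
  -- estimated is a difference of two values of `Dφ`.
  have hder : ∀ q, HasDerivAt (fun q => φ (euler b (t - q) z) - q * -(L (b z)))
      (fderiv ℝ φ (euler b (t - q) z) (-(b z)) - 1 * -(L (b z))) q := by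
    intro q
    refine HasDerivAt.sub ?_ ((hasDerivAt_id q).mul_const _)
    have h1 : HasDerivAt (fun q => euler b (t - q) z) (-(b z)) q := by
      simpa [euler] using (((hasDerivAt_id q).const_sub t).smul_const (b z)).const_add z
    exact ((hφ.differentiable one_ne_zero) _).hasFDerivAt.comp_hasDerivAt q h1
  have hconv := (convex_uIcc r s).norm_image_sub_le_of_norm_hasDerivWithin_le (C := ε)
    (fun q _ => (hder q).hasDerivWithinAt) (fun q hq => ?_) left_mem_uIcc right_mem_uIcc
  · rw [Real.norm_eq_abs, Real.norm_eq_abs] at hconv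
    refine le_trans (le_of_eq (congrArg _ ?_)) hconv
    ring
  · have hq' : |q - r| ≤ |s - r| := by
      simpa using abs_sub_left_of_mem_uIcc hq
    have hqs : dist (euler b (t - q) z) (euler b (t - r) z) < δ := by
      rw [dist_eq_norm, euler, euler, add_sub_add_left_eq_sub, ← sub_smul, norm_smul]
      have : ‖t - q - (t - r)‖ = |q - r| := by rw [Real.norm_eq_abs, abs_sub_comm]; ring_nf
      rw [this]
      have hs' : |s - r| < δ / B := by
        have := Metric.ball_subset_ball (min_le_right ρ (δ / B)) hs
        rwa [Metric.mem_ball, Real.dist_eq] at this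
      calc |q - r| * ‖b z‖ ≤ |s - r| * B := mul_le_mul hq' hbz (norm_nonneg _) (abs_nonneg _)
        _ < δ / B * B := by gcongr
        _ = δ := by field_simp
    have := hδ' hqs
    rw [dist_eq_norm] at this
    have e : fderiv ℝ φ (euler b (t - q) z) (-(b z)) - 1 * -(L (b z)) =
        -((fderiv ℝ φ (euler b (t - q) z) - L) (b z)) := by simp [L]; ring
    rw [e, norm_neg]
    calc _ ≤ ε / B * B := ContinuousLinearMap.le_of_opNorm_le_of_le _ this.le hbz
      _ = ε := by field_simp

end Euler

end

/-! ### Weighted tests and the error of one Euler step. -/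

section

variable {V : R3 → ℝ} {C : ℝ} {Δ : Set ℝ} {M : ℝ → SignedMeasure Phase}

/-- Compactly supported `C¹` functions bounded by `1` whose derivative decays like
`1 / (1 + η‖z‖)`. -/
structure IsWeightedTest (η : ℝ) (φ : Phase → ℝ) : Prop where
  contDiff : ContDiff ℝ 1 φ
  hasCompactSupport : HasCompactSupport φ
  abs_le : ∀ z, |φ z| ≤ 1
  fderiv_le : ∀ z, (1 + η * ‖z‖) * ‖fderiv ℝ φ z‖ ≤ 1

/-- The force is uniformly continuous in time, with respect to a weight growing in space. -/
lemma IsCompactlyWeakSolution.exists_gradConv_sub_le (hg : IsC1b (∇ V) C)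
    (h : IsCompactlyWeakSolution V Δ M) {a b : ℝ} (hab : Icc a b ⊆ Δ) {η ε : ℝ} (hη : 0 < η)
    (hε : 0 < ε) : ∃ δ > 0, ∀ r ∈ Icc a b, ∀ s ∈ Icc a b, |r - s| ≤ δ → ∀ x,
      ‖gradConv V (M r) x - gradConv V (M s) x‖ ≤ ε * (1 + η * ‖x‖) := by
  obtain ⟨m, hm⟩ := h.bounded a b hab
  rcases (Icc a b).eq_empty_or_nonempty with he | ⟨t₀, ht₀⟩
  · exact ⟨1, one_pos, by simp [he]⟩
  have hC := hg.nonneg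
  have hm0 : 0 ≤ m := measureReal_nonneg.trans (hm t₀ ht₀)
  have hcm : ∀ r ∈ Icc a b, C * (M r).variation.real univ ≤ C * m := fun r hr =>
    mul_le_mul_of_nonneg_left (hm r hr) hC
  -- Beyond this radius the trivial bound `2Cm` is already below `εη‖x‖`; only a compact ball
  -- remains.
  set R := 2 * (C * m) / (ε * η)
  -- Continuity in time for each `x` and a Lipschitz constant in `x` uniform in time give joint
  -- continuity.
  have hcont : ContinuousOn (fun p : ℝ × R3 => gradConv V (M p.1) p.2) (Icc a b ×ˢ univ) := by
    refine continuousOn_prod_of_continuousOn_lipschitzOnWith' _ (C * m).toNNReal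
      (fun r hr => LipschitzWith.lipschitzOnWith ?_) fun x _ => (h.continuous x).mono hab
    refine LipschitzWith.of_dist_le_mul fun x y => ?_
    rw [dist_eq_norm, dist_eq_norm, Real.coe_toNNReal _ (by positivity)]
    exact ((isC1b_gradConv hg (M r)).norm_sub_le x y).trans
      (mul_le_mul_of_nonneg_right (hcm r hr) (norm_nonneg _))
  have huc := (isCompact_Icc.prod (isCompact_closedBall (0 : R3) R)).uniformContinuousOn_of_continuous
    (hcont.mono (prod_mono subset_rfl (subset_univ _)))
  obtain ⟨δ, hδ, hδ'⟩ := Metric.uniformContinuousOn_iff_le.1 huc ε hε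
  refine ⟨δ, hδ, fun r hr s hs hrs x => ?_⟩
  have hw : 1 ≤ 1 + η * ‖x‖ := by linarith [mul_nonneg hη.le (norm_nonneg x)]
  rcases le_or_gt ‖x‖ R with hx | hx
  · have := hδ' (r, x) ⟨hr, by simpa using hx⟩ (s, x) ⟨hs, by simpa using hx⟩
      (by simpa [Prod.dist_eq, Real.dist_eq, hδ.le] using hrs)
    rw [dist_eq_norm] at this
    exact this.trans (le_mul_of_one_le_right hε.le hw)
  · have h1 : ‖gradConv V (M r) x - gradConv V (M s) x‖ ≤ C * m + C * m :=
      (norm_sub_le _ _).trans (add_le_add ((norm_gradConv_le hg _ x).trans (hcm r hr))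
        ((norm_gradConv_le hg _ x).trans (hcm s hs)))
    have h2 : 2 * (C * m) < ‖x‖ * (ε * η) := (div_lt_iff₀ (by positivity)).1 hx
    nlinarith

/-- The decay of `Dφ` at `y` cancels the growth of `v` in `z`, since `‖z‖ ≤ 2‖y‖ + c` makes the two
weights comparable. Trading `1 + ‖z‖` for the `η`-weight costs `1/η`, but only in the term that
carries the factor `τ`. -/
lemma IsWeightedTest.fderiv_apply_le {η c ε τ : ℝ} {φ : Phase → ℝ} (hφ : IsWeightedTest η φ)
    (hη : 0 < η) (hη1 : η ≤ 1) (hc : 0 ≤ c) {z y v : Phase} (hy : ‖z‖ ≤ 2 * ‖y‖ + c) (hε : 0 ≤ ε)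
    (hτ : 0 ≤ τ) (hv : ‖v‖ ≤ ε * (1 + η * ‖z‖) + τ * (2 * c * (1 + ‖z‖))) :
    |fderiv ℝ φ y v| ≤ (2 + c) * (ε + τ * (2 * c / η)) := by
  have hyw : 0 < 1 + η * ‖y‖ := by positivity
  have h1 : ‖fderiv ℝ φ y‖ ≤ 1 / (1 + η * ‖y‖) := by
    rw [le_div_iff₀ hyw, mul_comm]; exact hφ.fderiv_le y
  have h2 : 1 + η * ‖z‖ ≤ (2 + c) * (1 + η * ‖y‖) := by
    have := mul_le_mul_of_nonneg_left hy hη.le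
    nlinarith [mul_nonneg hη.le (norm_nonneg y), mul_le_mul_of_nonneg_right hη1 hc,
      mul_nonneg hc (mul_nonneg hη.le (norm_nonneg y))]
  have h3 : 1 + ‖z‖ ≤ (1 + η * ‖z‖) / η := by
    rw [le_div_iff₀ hη]; nlinarith [norm_nonneg z]
  have h4 : ‖v‖ ≤ (ε + τ * (2 * c / η)) * (1 + η * ‖z‖) := by
    refine hv.trans ?_
    have : τ * (2 * c * (1 + ‖z‖)) ≤ τ * (2 * c * ((1 + η * ‖z‖) / η)) := by gcongr
    calc _ ≤ ε * (1 + η * ‖z‖) + τ * (2 * c * ((1 + η * ‖z‖) / η)) := by gcongr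
      _ = _ := by ring
  have h5 : ‖v‖ ≤ (ε + τ * (2 * c / η)) * ((2 + c) * (1 + η * ‖y‖)) :=
    h4.trans (mul_le_mul_of_nonneg_left h2 (by positivity))
  calc |fderiv ℝ φ y v| ≤ 1 / (1 + η * ‖y‖) *
        ((ε + τ * (2 * c / η)) * ((2 + c) * (1 + η * ‖y‖))) :=
        ContinuousLinearMap.le_of_opNorm_le_of_le _ h1 h5
    _ = _ := by field_simp

/-- Both fields have the same first component, so their difference is the difference of the forces;
the remaining term is `τ` times a quantity of linear growth. -/
lemma norm_field_add_sub_le (hg : IsC1b (∇ V) C) {μ ν : SignedMeasure Phase} {c ε η τ : ℝ}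
    (hμ : C * μ.variation.real univ ≤ c) (hν : C * ν.variation.real univ ≤ c) (z : Phase)
    (hε : 0 ≤ ε) (hη : 0 < η)
    (h : ‖gradConv V ν z.1 - gradConv V μ z.1‖ ≤ ε * (1 + η * ‖z.1‖)) :
    ‖field V ν z + τ • fderiv ℝ (field V μ) z (field V ν z) - field V μ z‖ ≤
      ε * (1 + η * ‖z‖) + |τ| * (2 * c * (1 + ‖z‖)) := by
  have hc : 0 ≤ c := le_trans (mul_nonneg hg.nonneg measureReal_nonneg) hμ
  have e : field V ν z + τ • fderiv ℝ (field V μ) z (field V ν z) - field V μ z =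
      (0, gradConv V ν z.1 - gradConv V μ z.1) +
        τ • fderiv ℝ (field V μ) z (field V ν z) := by
    simp only [field]
    ext <;> simp
    ring
  rw [e]
  refine (norm_add_le _ _).trans (add_le_add ?_ ?_)
  · rw [Prod.norm_mk, norm_zero, max_eq_right (norm_nonneg _)]
    refine h.trans ?_
    gcongr
    exact norm_fst_le z
  · rw [norm_smul, Real.norm_eq_abs, fderiv_field_apply hg]
    refine mul_le_mul_of_nonneg_left (max_le ?_ ?_) (abs_nonneg τ)
    · change ‖(2 : ℝ) • gradConv V ν z.1‖ ≤ _
      rw [norm_smul, Real.norm_two]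
      nlinarith [(norm_gradConv_le hg ν z.1).trans hν, norm_nonneg z]
    · have h1 : ‖(field V ν z).1‖ ≤ 2 * ‖z‖ := by
        change ‖(2 : ℝ) • z.2‖ ≤ _
        rw [norm_smul, Real.norm_two]
        linarith [norm_snd_le z]
      refine (ContinuousLinearMap.le_of_opNorm_le_of_le _
        (((isC1b_gradConv hg μ).norm_fderiv_le z.1).trans hμ) h1).trans ?_
      nlinarith

/-- The function `r ↦ ∫ φ(z + (t - r) β(z)) dμ_r`, with the field `β` frozen at time `s`,
interpolates between the two integrals. Its derivative sees only the change of the force between `s`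
and `r` and a term of size `|t - r|`. -/
lemma IsCompactlyWeakSolution.exists_step_le (hg : IsC1b (∇ V) C)
    (h : IsCompactlyWeakSolution V Δ M) {a b : ℝ} (hab : Icc a b ⊆ Δ) {η ε : ℝ} (hη : 0 < η)
    (hη1 : η ≤ 1) (hε : 0 < ε) : ∃ δ > 0, ∀ s ∈ Icc a b, ∀ t ∈ Icc a b, |t - s| ≤ δ →
      ∀ φ, IsWeightedTest η φ →
      |∫ᵛ z, φ z ∂<•(M t) - ∫ᵛ z, φ (euler (field V (M s)) (t - s) z) ∂<•(M s)|
        ≤ ε * |t - s| := by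
  obtain ⟨m, hm⟩ := h.bounded a b hab
  rcases (Icc a b).eq_empty_or_nonempty with he | ⟨t₀, ht₀⟩
  · exact ⟨1, one_pos, by simp [he]⟩
  have hC := hg.nonneg
  have hm0 : 0 ≤ m := measureReal_nonneg.trans (hm t₀ ht₀)
  set c := C * m
  have hc : 0 ≤ c := by positivity
  have hcm : ∀ r ∈ Icc a b, C * (M r).variation.real univ ≤ c := fun r hr =>
    mul_le_mul_of_nonneg_left (hm r hr) hC
  -- The force change and, thanks to `δ₂`, the `|t - r|` term each contribute at most `ε₁`; the
  -- factor `2 + c` and the mass then bring the total to `ε`. The summands `+ 1` avoid division by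
  -- zero.
  set ε₁ := ε / (2 * (2 + c) * (m + 1))
  have hε₁ : 0 < ε₁ := by positivity
  obtain ⟨δ₁, hδ₁, hδ₁'⟩ := h.exists_gradConv_sub_le hg hab hη hε₁
  set δ₂ := ε₁ * η / (2 * (c + 1))
  have hδ₂ : 0 < δ₂ := by positivity
  -- The value `1/8` keeps `|t - r|` strictly below `1/4`, so properness of the Euler map persists
  -- at nearby times.
  refine ⟨min (1 / 8) (min δ₁ δ₂), by positivity, fun s hs t ht hts φ hφ => ?_⟩
  have hts₀ := hts.trans (min_le_left _ _)
  have hts₁ := (hts.trans (min_le_right _ _)).trans (min_le_left _ _)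
  have hts₂ := (hts.trans (min_le_right _ _)).trans (min_le_right _ _)
  set β := field V (M s)
  have hβ : ContDiff ℝ 1 β := contDiff_field hg (M s)
  have hβc : ∀ z, ‖β z‖ ≤ 2 * ‖z‖ + c :=
    norm_field_le fun x => (norm_gradConv_le hg _ x).trans (hcm s hs)
  have hsub : uIcc s t ⊆ Icc a b := uIcc_subset_Icc hs ht
  have htq : ∀ r ∈ uIcc s t, |t - r| ≤ |t - s| := fun r hr => abs_sub_right_of_mem_uIcc hr
  have hder : ∀ r ∈ uIcc s t, HasDerivAt
      (fun r => ∫ᵛ z, φ (euler β (t - r) z) ∂<•(M r))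
      (∫ᵛ z, (fderiv ℝ (fun z => φ (euler β (t - r) z)) z (field V (M r) z) +
        -(fderiv ℝ φ (euler β (t - r) z) (β z))) ∂<•(M r)) r := by
    intro r hr
    have htr : |t - r| < 1 / 4 := ((htq r hr).trans hts₀).trans_lt (by norm_num)
    have hD : HasCompactSupport fun z => fderiv ℝ φ (euler β (t - r) z) :=
      hasCompactSupport_comp_euler (hφ.hasCompactSupport.fderiv ℝ) hc hβc htr.le
    refine h.hasDerivAt_integral_time_dependent hg (u := fun r z => φ (euler β (t - r) z))
      (hab (hsub hr)) (fun q => hφ.contDiff.comp (contDiff_euler hβ _)) ?_ ?_ ?_ fun ε hε =>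
      eventually_comp_euler_sub_le hc hβc hφ.contDiff hφ.hasCompactSupport htr hε
    · have hev : ∀ᶠ q in 𝓝 r, |t - q| < 1 / 4 :=
        (continuous_const.sub continuous_id).abs.continuousAt.eventually_lt continuousAt_const htr
      filter_upwards [hev] with q hq
      exact hasCompactSupport_comp_euler hφ.hasCompactSupport hc hβc hq.le
    · exact (((hφ.contDiff.continuous_fderiv one_ne_zero).comp
        (contDiff_euler hβ _).continuous).clm_apply hβ.continuous).neg
    · exact hD.mono fun z hz h0 => hz (by simp [h0])
  have hbound : ∀ r ∈ uIcc s t, ‖∫ᵛ z, (fderiv ℝ (fun z => φ (euler β (t - r) z)) z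
      (field V (M r) z) + -(fderiv ℝ φ (euler β (t - r) z) (β z))) ∂<•(M r)‖ ≤ ε := by
    intro r hr
    have htr : |t - r| ≤ 1 / 4 := ((htq r hr).trans hts₀).trans (by norm_num)
    have hrs : |r - s| ≤ δ₁ := (abs_sub_left_of_mem_uIcc hr).trans hts₁
    set K := (2 + c) * (ε₁ + |t - r| * (2 * c / η))
    have hK : K ≤ (2 + c) * (2 * ε₁) := by
      have : |t - r| * (2 * c / η) ≤ ε₁ := by
        calc |t - r| * (2 * c / η) ≤ δ₂ * (2 * c / η) := by
              gcongr; exact (htq r hr).trans hts₂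
          _ = ε₁ * (c / (c + 1)) := by simp only [δ₂]; field_simp
          _ ≤ ε₁ * 1 := by
              gcongr; rw [div_le_one (by positivity)]; linarith
          _ = ε₁ := mul_one _
      have : 0 ≤ 2 + c := by positivity
      simp only [K]; gcongr; linarith
    have hK0 : 0 ≤ K := by positivity
    refine (norm_integral_le_mul_variation (C := K) (fun z => ?_) hK0).trans ?_
    · rw [fderiv_comp_euler hβ hφ.contDiff, ← sub_eq_add_neg, ← map_sub, Real.norm_eq_abs]
      exact hφ.fderiv_apply_le hη hη1 hc (norm_le_norm_euler hc hβc htr z) hε₁.le (abs_nonneg _)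
        (norm_field_add_sub_le hg (hcm s hs) (hcm r (hsub hr)) z hε₁.le hη
          (hδ₁' r (hsub hr) s hs hrs z.1))
    · calc K * (M r).variation.real univ ≤ (2 + c) * (2 * ε₁) * (m + 1) := by
            refine mul_le_mul hK ((hm r (hsub hr)).trans (by linarith)) measureReal_nonneg
              (by positivity)
        _ = ε := by simp only [ε₁]; field_simp
  have := (convex_uIcc s t).norm_image_sub_le_of_norm_hasDerivWithin_le
    (fun r hr => (hder r hr).hasDerivWithinAt) hbound left_mem_uIcc right_mem_uIcc
  simpa [euler] using this

end

/-! ### The dual norm: stability under Euler steps and control of the force. -/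

section

variable {V : R3 → ℝ} {C : ℝ} {Δ : Set ℝ} {M M' : ℝ → SignedMeasure Phase}

lemma IsWeightedTest.norm_sub_le {η : ℝ} (hη : 0 ≤ η) {φ : Phase → ℝ} (hφ : IsWeightedTest η φ)
    (y z : Phase) : |φ y - φ z| ≤ ‖y - z‖ := by
  have h := convex_univ.norm_image_sub_le_of_norm_fderiv_le (f := φ) (𝕜 := ℝ) (C := 1)
    (fun x _ => hφ.contDiff.differentiable one_ne_zero x) (fun x _ => ?_) (mem_univ z) (mem_univ y)
  · simpa using h
  · refine le_trans ?_ (hφ.fderiv_le x)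
    exact le_mul_of_one_le_left (norm_nonneg _) (by linarith [mul_nonneg hη (norm_nonneg x)])

/-- The pairing with `μ - ν` is at most `B` on all weighted test functions. -/
def PairingLE (η : ℝ) (μ ν : SignedMeasure Phase) (B : ℝ) : Prop :=
  ∀ φ, IsWeightedTest η φ → |∫ᵛ z, φ z ∂<•μ - ∫ᵛ z, φ z ∂<•ν| ≤ B

lemma PairingLE.abs_sub_le {η k B : ℝ} {μ ν : SignedMeasure Phase} (h : PairingLE η μ ν B)
    (hk : 0 < k) {ψ : Phase → ℝ} (hψ : ContDiff ℝ 1 ψ) (hc : HasCompactSupport ψ)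
    (h1 : ∀ z, |ψ z| ≤ k) (h2 : ∀ z, (1 + η * ‖z‖) * ‖fderiv ℝ ψ z‖ ≤ k) :
    |∫ᵛ z, ψ z ∂<•μ - ∫ᵛ z, ψ z ∂<•ν| ≤ k * B := by
  have ht : IsWeightedTest η (fun z => k⁻¹ • ψ z) := by
    refine ⟨hψ.const_smul _, hc.mono fun z hz h0 => hz (by simp [h0]), fun z => ?_, fun z => ?_⟩
    · rw [smul_eq_mul, abs_mul, abs_of_pos (inv_pos.2 hk), inv_mul_le_iff₀ hk, mul_one]
      exact h1 z
    · rw [fderiv_fun_const_smul (hψ.differentiable one_ne_zero z), norm_smul, Real.norm_eq_abs,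
        abs_of_pos (inv_pos.2 hk), mul_left_comm, inv_mul_le_iff₀ hk, mul_one]
      exact h2 z
  have := h _ ht
  rw [VectorMeasure.integral_fun_smul, VectorMeasure.integral_fun_smul, ← smul_sub, smul_eq_mul,
    abs_mul, abs_of_pos (inv_pos.2 hk), inv_mul_le_iff₀ hk] at this
  exact this

/-- The growth rate of the weighted test class under Euler steps along a force bounded by `c`. -/
def growthRate (c : ℝ) : ℝ := 6 + 4 * c + (4 + 3 * c) * (2 + c)

lemma growthRate_pos {c : ℝ} (hc : 0 ≤ c) : 0 < growthRate c := by
  unfold growthRate; positivity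

lemma norm_fderiv_field_le (hg : IsC1b (∇ V) C) {μ : SignedMeasure Phase} {c : ℝ}
    (hμ : C * μ.variation.real univ ≤ c) (z : Phase) : ‖fderiv ℝ (field V μ) z‖ ≤ 2 + c := by
  have hc : 0 ≤ c := le_trans (mul_nonneg hg.nonneg measureReal_nonneg) hμ
  refine ContinuousLinearMap.opNorm_le_bound _ (by positivity) fun w => ?_
  rw [fderiv_field_apply hg]
  refine max_le ?_ ?_
  · change ‖(2 : ℝ) • w.2‖ ≤ _
    rw [norm_smul, Real.norm_two]
    nlinarith [norm_snd_le w, norm_nonneg w]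
  · refine (ContinuousLinearMap.le_of_opNorm_le_of_le _
      (((isC1b_gradConv hg μ).norm_fderiv_le z.1).trans hμ) (norm_fst_le w)).trans ?_
    nlinarith [norm_nonneg w]

/-- Up to the stated factor, the composed test is again a weighted test: the derivative of the Euler
map is `1 + O(|τ|)`, and so is the ratio of the weights at `z` and at its image. -/
lemma PairingLE.comp_euler (hg : IsC1b (∇ V) C) {η B c τ : ℝ} (hη : 0 < η) (hη1 : η ≤ 1)
    {μ ν ρ : SignedMeasure Phase} (h : PairingLE η μ ν B) (hρ : C * ρ.variation.real univ ≤ c)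
    (hτ : |τ| ≤ 1 / 4) {φ : Phase → ℝ} (hφ : IsWeightedTest η φ) :
    |∫ᵛ z, φ (euler (field V ρ) τ z) ∂<•μ - ∫ᵛ z, φ (euler (field V ρ) τ z) ∂<•ν|
      ≤ (1 + growthRate c * |τ|) * B := by
  have hc : 0 ≤ c := le_trans (mul_nonneg hg.nonneg measureReal_nonneg) hρ
  have hβ := contDiff_field hg ρ
  have hβc : ∀ z, ‖field V ρ z‖ ≤ 2 * ‖z‖ + c :=
    norm_field_le fun x => (norm_gradConv_le hg _ x).trans hρ
  have hκ := growthRate_pos hc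
  have hτ0 := abs_nonneg τ
  refine h.abs_sub_le (by positivity) (hφ.contDiff.comp (contDiff_euler hβ τ))
    (hasCompactSupport_comp_euler hφ.hasCompactSupport hc hβc hτ)
    (fun z => (hφ.abs_le _).trans (le_add_of_nonneg_right (by positivity))) fun z => ?_
  set y := euler (field V ρ) τ z
  have hD : ‖fderiv ℝ (fun z => φ (euler (field V ρ) τ z)) z‖ ≤
      ‖fderiv ℝ φ y‖ * (1 + |τ| * (2 + c)) := by
    refine ContinuousLinearMap.opNorm_le_bound _ (by positivity) fun v => ?_
    rw [fderiv_comp_euler hβ hφ.contDiff, mul_assoc]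
    refine (ContinuousLinearMap.le_opNorm _ _).trans
      (mul_le_mul_of_nonneg_left ?_ (norm_nonneg _))
    refine (norm_add_le _ _).trans ?_
    rw [norm_smul, add_mul, one_mul, mul_assoc, Real.norm_eq_abs]
    gcongr
    exact ContinuousLinearMap.le_of_opNorm_le _ (norm_fderiv_field_le hg hρ z) v
  have hz : ‖z‖ ≤ 2 * ‖y‖ + c := norm_le_norm_euler hc hβc hτ z
  have hzy : ‖z‖ ≤ ‖y‖ + |τ| * (4 * ‖y‖ + 3 * c) := by
    have h1 : ‖z‖ ≤ ‖y‖ + ‖τ • field V ρ z‖ := by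
      simpa [y, euler] using _root_.norm_sub_le (z + τ • field V ρ z) (τ • field V ρ z)
    refine h1.trans ?_
    rw [norm_smul, Real.norm_eq_abs]
    gcongr
    linarith [hβc z]
  have hw : 1 + η * ‖z‖ ≤ (1 + (4 + 3 * c) * |τ|) * (1 + η * ‖y‖) := by
    have h1 := mul_le_mul_of_nonneg_left hzy hη.le
    have h2 : η * (3 * c * |τ|) ≤ 1 * (3 * c * |τ|) := by gcongr
    have h3 : 0 ≤ 3 * c * |τ| * (η * ‖y‖) := by positivity
    nlinarith
  calc (1 + η * ‖z‖) * ‖fderiv ℝ (fun z => φ (euler (field V ρ) τ z)) z‖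
      ≤ ((1 + (4 + 3 * c) * |τ|) * (1 + η * ‖y‖)) *
        (‖fderiv ℝ φ y‖ * (1 + |τ| * (2 + c))) := by gcongr
    _ = ((1 + (4 + 3 * c) * |τ|) * (1 + |τ| * (2 + c))) *
        ((1 + η * ‖y‖) * ‖fderiv ℝ φ y‖) := by ring
    _ ≤ ((1 + (4 + 3 * c) * |τ|) * (1 + |τ| * (2 + c))) * 1 :=
        mul_le_mul_of_nonneg_left (hφ.fderiv_le y) (by positivity)
    -- Expanding the product gives `6 + 4c` at first order and `(4 + 3c)(2 + c)` at second order;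
    -- `|τ|² ≤ |τ|` merges them into `growthRate`.
    _ ≤ 1 + growthRate c * |τ| := by
        unfold growthRate
        have : |τ| * |τ| ≤ |τ| * 1 := mul_le_mul_of_nonneg_left (by linarith) hτ0
        nlinarith [mul_le_mul_of_nonneg_left this
          (show 0 ≤ (4 + 3 * c) * (2 + c) by positivity)]

/-- Cutoff functions at scale `η⁻¹` with uniformly bounded derivative. -/
lemma exists_cutoff : ∃ D : ℝ, 0 ≤ D ∧ ∀ η : ℝ, 0 < η → η ≤ 1 → ∃ χ : Phase → ℝ,
    ContDiff ℝ 1 χ ∧ HasCompactSupport χ ∧ (∀ w, |χ w| ≤ 1) ∧ (∀ w, ‖fderiv ℝ χ w‖ ≤ D) ∧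
      (∀ w ∈ tsupport χ, η * ‖w‖ ≤ 2) ∧ ∀ w, η * ‖w‖ ≤ 1 → χ w = 1 := by
  obtain ⟨b, hb1, hb2⟩ : ∃ b : ContDiffBump (0 : Phase), b.rIn = 1 ∧ b.rOut = 2 :=
    ⟨⟨1, 2, one_pos, one_lt_two⟩, rfl, rfl⟩
  have hb : ContDiff ℝ 1 b := b.contDiff
  obtain ⟨D, hD⟩ := (b.hasCompactSupport.fderiv ℝ).exists_bound_of_continuous
    (hb.continuous_fderiv one_ne_zero)
  have hD0 : 0 ≤ D := (norm_nonneg _).trans (hD 0)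
  refine ⟨D, hD0, fun η hη hη1 => ⟨fun w => b (η • w), hb.comp (contDiff_const_smul η), ?_, ?_,
    fun w => ?_, ?_, fun w hw => b.one_of_mem_closedBall ?_⟩⟩
  · refine HasCompactSupport.intro (isCompact_closedBall (0 : Phase) (2 / η)) fun w hw => ?_
    have : 2 / η < ‖w‖ := by simpa using hw
    rw [div_lt_iff₀ hη] at this
    refine b.zero_of_le_dist ?_
    rw [hb2, dist_zero_right, norm_smul, Real.norm_eq_abs, abs_of_pos hη]
    linarith
  · exact fun w => (abs_of_nonneg b.nonneg).trans_le b.le_one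
  · rw [fderiv_comp_smul, norm_smul, Real.norm_eq_abs, abs_of_pos hη]
    exact (mul_le_of_le_one_left (norm_nonneg _) hη1).trans (hD _)
  · have hcl : IsClosed {w : Phase | η * ‖w‖ ≤ 2} := isClosed_le (by fun_prop) continuous_const
    refine closure_minimal (fun w hw => ?_) hcl
    by_contra hlt
    refine hw (b.zero_of_le_dist ?_)
    rw [hb2, dist_zero_right, norm_smul, Real.norm_eq_abs, abs_of_pos hη]
    exact (not_le.1 hlt).le
  · rw [hb1, mem_closedBall_zero_iff, norm_smul, Real.norm_eq_abs, abs_of_pos hη]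
    exact hw

/-- On the support of the cutoff the weight is at most `3`, so `χψ` is a multiple of a weighted test
with a constant independent of `η`. -/
lemma PairingLE.abs_sub_le_of_cutoff {η B C D : ℝ} {μ ν : SignedMeasure Phase}
    (h : PairingLE η μ ν B) {χ ψ : Phase → ℝ} (hχ : ContDiff ℝ 1 χ)
    (hχc : HasCompactSupport χ) (hχ1 : ∀ w, |χ w| ≤ 1) (hχD : ∀ w, ‖fderiv ℝ χ w‖ ≤ D)
    (hχs : ∀ w ∈ tsupport χ, η * ‖w‖ ≤ 2) (hψ : IsC1b ψ C) :
    |∫ᵛ w, χ w * ψ w ∂<•μ - ∫ᵛ w, χ w * ψ w ∂<•ν| ≤ (3 * (C * (1 + D)) + 1) * B := by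
  have hC := hψ.nonneg
  have hD : 0 ≤ D := (norm_nonneg _).trans (hχD 0)
  refine h.abs_sub_le (by positivity) (hχ.mul hψ.contDiff) hχc.mul_right (fun w => ?_) fun w => ?_
  · rw [abs_mul]
    refine (mul_le_of_le_one_left (abs_nonneg _) (hχ1 w)).trans ((hψ.norm_le w).trans ?_)
    nlinarith [mul_nonneg hC hD]
  · have e : fderiv ℝ (fun w => χ w * ψ w) w = χ w • fderiv ℝ ψ w + ψ w • fderiv ℝ χ w :=
      fderiv_fun_mul (hχ.differentiable one_ne_zero w) (hψ.differentiable w)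
    by_cases hw : w ∈ tsupport χ
    · have h2 : ‖fderiv ℝ (fun w => χ w * ψ w) w‖ ≤ C * (1 + D) := by
        rw [e]
        refine (norm_add_le _ _).trans ?_
        rw [norm_smul, norm_smul, mul_add, mul_one]
        exact add_le_add
          ((mul_le_of_le_one_left (norm_nonneg _) (hχ1 w)).trans (hψ.norm_fderiv_le w))
          (mul_le_mul (hψ.norm_le w) (hχD w) (norm_nonneg _) hC)
      have h3 := mul_le_mul (show 1 + η * ‖w‖ ≤ 3 by linarith [hχs w hw]) h2
        (norm_nonneg _) (by norm_num)
      linarith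
    · have h0 : fderiv ℝ χ w = 0 :=
        image_eq_zero_of_notMem_tsupport fun h => hw (tsupport_fderiv_subset ℝ h)
      rw [e, h0, image_eq_zero_of_notMem_tsupport hw, zero_smul, smul_zero, add_zero, norm_zero,
        mul_zero]
      positivity

lemma IsC1b.comp_const_sub_fst {g : R3 → R3} (hg : IsC1b g C) (x : R3) {L : R3 →L[ℝ] ℝ}
    (hL : ‖L‖ ≤ 1) : IsC1b (fun w : Phase => L (g (x - w.1))) C where
  contDiff := L.contDiff.comp (hg.contDiff.comp (contDiff_const.sub contDiff_fst))
  norm_le w := (L.le_of_opNorm_le_of_le hL (hg.norm_le _)).trans (one_mul C).le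
  norm_fderiv_le w := by
    have h1 : HasFDerivAt (fun w : Phase => x - w.1) (-ContinuousLinearMap.fst ℝ R3 R3) w :=
      hasFDerivAt_fst.const_sub x
    have h2 := (L.hasFDerivAt.comp w ((hg.differentiable _).hasFDerivAt.comp w h1)).fderiv
    rw [show fderiv ℝ (fun w : Phase => L (g (x - w.1))) w = _ from h2]
    refine ContinuousLinearMap.opNorm_le_bound _ hg.nonneg fun v => ?_
    have h3 : ‖(-ContinuousLinearMap.fst ℝ R3 R3) v‖ ≤ ‖v‖ := by simpa using norm_fst_le v
    exact (L.le_of_opNorm_le_of_le hL (ContinuousLinearMap.le_of_opNorm_le_of_le _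
      (hg.norm_fderiv_le _) h3)).trans (one_mul _).le

/-- The distance of two forces is controlled by the pairing with weighted test functions. -/
lemma exists_gradConv_sub_le_of_pairingLE (hg : IsC1b (∇ V) C) : ∃ k > 0,
    ∀ (μ ν : SignedMeasure Phase) (B : ℝ),
      (∀ η, 0 < η → η ≤ 1 → PairingLE η μ ν B) → ∀ x,
        ‖gradConv V μ x - gradConv V ν x‖ ≤ k * B := by
  have hC := hg.nonneg
  obtain ⟨D, hD0, hD⟩ := exists_cutoff
  refine ⟨3 * (C * (1 + D)) + 1, by positivity, fun μ ν B hB x => ?_⟩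
  -- A norming functional reduces the vector-valued force to a scalar test.
  obtain ⟨L, hL, hLv⟩ := exists_dual_vector'' ℝ (gradConv V μ x - gradConv V ν x)
  have hψ := hg.comp_const_sub_fst x hL
  set ψ : Phase → ℝ := fun w => L (∇ V (x - w.1))
  have hint : ∀ ρ : SignedMeasure Phase, ∫ᵛ w, ψ w ∂<•ρ = L (gradConv V ρ x) := fun ρ =>
    integral_clm_comp L (integrable_gradient_sub hg ρ x)
  have hη : ∀ n : ℕ, (0 : ℝ) < 1 / ((n : ℝ) + 1) := fun n => by positivity
  have hη1 : ∀ n : ℕ, 1 / ((n : ℝ) + 1) ≤ 1 := fun n => by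
    rw [div_le_one (by positivity)]; linarith [n.cast_nonneg (α := ℝ)]
  choose χ hχ hχc hχ1 hχD hχs hχe using fun n : ℕ => hD _ (hη n) (hη1 n)
  -- The cutoffs at scale `n + 1` tend to `1`, and the bound is the same for each of them.
  have hlim : ∀ ρ : SignedMeasure Phase,
      Tendsto (fun n : ℕ => ∫ᵛ w, χ n w * ψ w ∂<•ρ) atTop (𝓝 (∫ᵛ w, ψ w ∂<•ρ)) := by
    intro ρ
    refine VectorMeasure.tendsto_integral_of_dominated_convergence (fun _ => C) (fun n => ?_)
      (integrable_const C) (fun n => ae_of_all _ fun w => ?_) (ae_of_all _ fun w => ?_)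
    · exact ((hχ n).continuous.mul hψ.continuous).aestronglyMeasurable
    · rw [norm_mul]
      exact (mul_le_of_le_one_left (norm_nonneg _) (hχ1 n w)).trans (hψ.norm_le w)
    · have h1 : Tendsto (fun n : ℕ => 1 / ((n : ℝ) + 1) * ‖w‖) atTop (𝓝 0) := by
        simpa using tendsto_one_div_add_atTop_nhds_zero_nat.mul_const ‖w‖
      refine tendsto_const_nhds.congr' ?_
      filter_upwards [h1.eventually_le_const one_pos] with n hn
      rw [hχe n w hn, one_mul]
  have hn : ∀ n : ℕ, |∫ᵛ w, χ n w * ψ w ∂<•μ - ∫ᵛ w, χ n w * ψ w ∂<•ν| ≤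
      (3 * (C * (1 + D)) + 1) * B := fun n =>
    (hB _ (hη n) (hη1 n)).abs_sub_le_of_cutoff (hχ n) (hχc n) (hχ1 n) (hχD n) (hχs n) hψ
  have := le_of_tendsto ((hlim μ).sub (hlim ν)).abs (Eventually.of_forall hn)
  rw [hint, hint, ← map_sub, hLv] at this
  simpa using this

end

/-! ### Discrete Gronwall argument and uniqueness. -/

section

variable {V : R3 → ℝ} {C : ℝ} {Δ : Set ℝ} {M M' : ℝ → SignedMeasure Phase}

/-- Weighted tests are `1`-Lipschitz, and the two Euler images differ by `τ` times the difference of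
the forces. -/
lemma norm_integral_comp_euler_sub_le (hg : IsC1b (∇ V) C) {μ ν ρ : SignedMeasure Phase}
    {c m τ η B : ℝ} (hμ : C * μ.variation.real univ ≤ c) (hν : C * ν.variation.real univ ≤ c)
    (hρ : ρ.variation.real univ ≤ m) (hτ : |τ| ≤ 1 / 4) (hη : 0 ≤ η)
    (hB : ∀ x, ‖gradConv V μ x - gradConv V ν x‖ ≤ B) {φ : Phase → ℝ}
    (hφ : IsWeightedTest η φ) :
    |∫ᵛ z, φ (euler (field V μ) τ z) ∂<•ρ - ∫ᵛ z, φ (euler (field V ν) τ z) ∂<•ρ|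
      ≤ |τ| * B * m := by
  have hc : 0 ≤ c := le_trans (mul_nonneg hg.nonneg measureReal_nonneg) hμ
  have hB0 : 0 ≤ B := (norm_nonneg _).trans (hB 0)
  have hi : ∀ σ : SignedMeasure Phase, C * σ.variation.real univ ≤ c →
      Integrable (fun z => φ (euler (field V σ) τ z)) ρ.variation := fun σ hσ =>
    integrable_of_hasCompactSupport
      (hφ.contDiff.continuous.comp (contDiff_euler (contDiff_field hg σ) τ).continuous)
      (hasCompactSupport_comp_euler hφ.hasCompactSupport hc
        (norm_field_le fun x => (norm_gradConv_le hg _ x).trans hσ) hτ)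
  rw [← VectorMeasure.integral_fun_sub (hi μ hμ) (hi ν hν), ← Real.norm_eq_abs]
  refine (norm_integral_le_mul_variation (C := |τ| * B) (fun z => ?_) (by positivity)).trans
    (mul_le_mul_of_nonneg_left hρ (by positivity))
  refine (hφ.norm_sub_le hη _ _).trans ?_
  have e : euler (field V μ) τ z - euler (field V ν) τ z =
      τ • ((0 : R3), gradConv V μ z.1 - gradConv V ν z.1) := by
    rw [euler, euler, add_sub_add_left_eq_sub, ← smul_sub, field, field, Prod.mk_sub_mk, sub_self]
  rw [e, norm_smul, Real.norm_eq_abs, Prod.norm_mk, norm_zero, max_eq_right (norm_nonneg _)]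
  exact mul_le_mul_of_nonneg_left (hB _) (abs_nonneg _)

/-- One time step of the stability estimate for two weak solutions. -/
lemma exists_pairingLE_step (hg : IsC1b (∇ V) C) (h : IsCompactlyWeakSolution V Δ M)
    (h' : IsCompactlyWeakSolution V Δ M') {a b m : ℝ} (hab : Icc a b ⊆ Δ)
    (hm : ∀ t ∈ Icc a b, (M t).variation.real univ ≤ m)
    (hm' : ∀ t ∈ Icc a b, (M' t).variation.real univ ≤ m) {η ε : ℝ} (hη : 0 < η) (hη1 : η ≤ 1)
    (hε : 0 < ε) : ∃ δ > 0, ∀ s ∈ Icc a b, ∀ t ∈ Icc a b, |t - s| ≤ δ → ∀ B F : ℝ,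
      PairingLE η (M' s) (M s) B →
      (∀ x, ‖gradConv V (M' s) x - gradConv V (M s) x‖ ≤ F) →
      PairingLE η (M' t) (M t)
        (B + |t - s| * (ε + F * m + growthRate (C * m) * B)) := by
  obtain ⟨δ, hδ, H⟩ := h.exists_step_le hg hab hη hη1 (half_pos hε)
  obtain ⟨δ', hδ', H'⟩ := h'.exists_step_le hg hab hη hη1 (half_pos hε)
  refine ⟨min (1 / 4) (min δ δ'), by positivity, fun s hs t ht hts B F hB hF φ hφ => ?_⟩
  have hts₀ := hts.trans (min_le_left _ _)
  have h1 := H s hs t ht ((hts.trans (min_le_right _ _)).trans (min_le_left _ _)) φ hφ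
  have h2 := H' s hs t ht ((hts.trans (min_le_right _ _)).trans (min_le_right _ _)) φ hφ
  have hc := mul_le_mul_of_nonneg_left (hm s hs) hg.nonneg
  have hc' := mul_le_mul_of_nonneg_left (hm' s hs) hg.nonneg
  -- With both solutions replaced by Euler steps, the field of `M'` is exchanged for that of `M`
  -- against `M' s` (`h4`), and then `M' s` is compared with `M s` along the common field (`h3`).
  have h3 := hB.comp_euler hg hη hη1 hc hts₀ hφ
  have h4 := norm_integral_comp_euler_sub_le hg hc' hc (hm' s hs) hts₀ hη.le hF hφ
  rw [abs_le] at *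
  constructor <;> linarith [h1.1, h1.2, h2.1, h2.2, h3.1, h3.2, h4.1, h4.2]

/-- The old bound with `K` enters only through the force, where the size of `l` makes its effect at
most half. For fixed `η` the interval is cut into `N` equal steps, and the bound is propagated by `1
+ l|τ| ≤ exp (l|τ|)`. -/
lemma pairingLE_half (hg : IsC1b (∇ V) C) (h : IsCompactlyWeakSolution V Δ M)
    (h' : IsCompactlyWeakSolution V Δ M') {a b m k K l : ℝ} (hab : Icc a b ⊆ Δ)
    (h0 : (0 : ℝ) ∈ Icc a b) (h00 : M' 0 = M 0)
    (hm : ∀ t ∈ Icc a b, (M t).variation.real univ ≤ m)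
    (hm' : ∀ t ∈ Icc a b, (M' t).variation.real univ ≤ m) (hk0 : 0 ≤ k) (hK : 0 ≤ K)
    (hk : ∀ (μ ν : SignedMeasure Phase) (B : ℝ),
      (∀ η, 0 < η → η ≤ 1 → PairingLE η μ ν B) → ∀ x,
        ‖gradConv V μ x - gradConv V ν x‖ ≤ k * B)
    (hl : l = growthRate (C * m) + 2 * (k * m) + 1)
    (hP : ∀ t ∈ Icc a b, ∀ η, 0 < η → η ≤ 1 →
      PairingLE η (M' t) (M t) (K * Real.exp (l * |t|))) :
    ∀ t ∈ Icc a b, ∀ η, 0 < η → η ≤ 1 →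
      PairingLE η (M' t) (M t) (K / 2 * Real.exp (l * |t|)) := by
  intro t ht η hη hη1
  have hm0 : 0 ≤ m := measureReal_nonneg.trans (hm t ht)
  have hκ := growthRate_pos (mul_nonneg hg.nonneg hm0)
  set κ := growthRate (C * m)
  have hl0 : 0 ≤ l := by rw [hl]; positivity
  have key : ∀ ε > 0, PairingLE η (M' t) (M t) ((ε + K / 2) * Real.exp (l * |t|)) := by
    intro ε hε
    obtain ⟨δ, hδ, H⟩ := exists_pairingLE_step hg h h' hab hm hm' hη hη1 hε
    obtain ⟨N, hN⟩ := exists_nat_gt (|t| / δ)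
    have hN0 : (0 : ℝ) < N := (by positivity : 0 ≤ |t| / δ).trans_lt hN
    set τ := t / N
    have hτ : |τ| ≤ δ := by
      rw [abs_div, abs_of_pos hN0, div_le_iff₀ hN0, mul_comm]
      exact ((div_lt_iff₀ hδ).1 hN).le
    have hmem : ∀ j : ℕ, j ≤ N → (j : ℝ) * τ ∈ Icc a b := by
      intro j hj
      have := (convex_Icc a b).smul_mem_of_zero_mem h0 ht (t := (j : ℝ) / N)
        ⟨by positivity, by rw [div_le_one hN0]; exact_mod_cast hj⟩
      rw [smul_eq_mul, div_mul_eq_mul_div, mul_div_assoc] at this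
      exact this
    have hind : ∀ j : ℕ, j ≤ N → PairingLE η (M' (j * τ)) (M (j * τ))
        ((ε + K / 2) * Real.exp (l * (j * |τ|))) := by
      intro j
      induction j with
      | zero =>
        intro _ φ _
        simp only [Nat.cast_zero, zero_mul, mul_zero, h00, sub_self, abs_zero]
        positivity
      | succ j ih =>
        intro hj
        have hj' := (Nat.le_succ j).trans hj
        have hd : ((j + 1 : ℕ) : ℝ) * τ - j * τ = τ := by push_cast; ring
        have hF := hk (M' (j * τ)) (M (j * τ)) _ (hP _ (hmem j hj'))
        have hstep := H _ (hmem j hj') _ (hmem (j + 1) hj) (by rw [hd]; exact hτ) _ _ (ih hj') hF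
        rw [hd, abs_mul, abs_of_nonneg (a := (j : ℝ)) j.cast_nonneg] at hstep
        intro φ hφ
        refine (hstep φ hφ).trans ?_
        have hexp : Real.exp (l * (((j + 1 : ℕ) : ℝ) * |τ|)) =
            Real.exp (l * (j * |τ|)) * Real.exp (l * |τ|) := by
          rw [← Real.exp_add]; congr 1; push_cast; ring
        have h1 : 1 + l * |τ| ≤ Real.exp (l * |τ|) := by
          linarith [Real.add_one_le_exp (l * |τ|)]
        set e := Real.exp (l * (j * |τ|))
        have he : 1 ≤ e := Real.one_le_exp (by positivity)
        have h2 : (ε + K / 2) * e * (1 + l * |τ|) ≤ (ε + K / 2) * (e * Real.exp (l * |τ|)) := by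
          rw [mul_assoc]; gcongr
        rw [hexp]
        refine le_trans ?_ h2
        -- In `l` the summand `2km` multiplied by `K/2` pays for the force term, and the summand `1`
        -- pays for `ε`.
        have h3 : ε + k * (K * e) * m + κ * ((ε + K / 2) * e) ≤ l * ((ε + K / 2) * e) := by
          rw [hl]
          have : ε ≤ ε * e := le_mul_of_one_le_right hε.le he
          have : 0 ≤ k * m * (ε * e) := by positivity
          have : 0 ≤ K * e := by positivity
          nlinarith
        nlinarith [mul_le_mul_of_nonneg_left h3 (abs_nonneg τ)]
    have hfin := hind N le_rfl
    have e1 : (N : ℝ) * τ = t := by simp only [τ]; field_simp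
    have e2 : (N : ℝ) * |τ| = |t| := by
      calc (N : ℝ) * |τ| = |N * τ| := by rw [abs_mul, abs_of_pos hN0]
        _ = |t| := by rw [e1]
    rwa [e1, e2] at hfin
  intro φ hφ
  refine le_of_forall_pos_le_add fun ε hε => ?_
  have hE := Real.exp_pos (l * |t|)
  refine (key (ε / Real.exp (l * |t|)) (by positivity) φ hφ).trans (le_of_eq ?_)
  field_simp
  ring

/-- Every smooth compactly supported function is a multiple of a weighted test, and such functions
are uniformly dense in the compactly supported continuous ones. -/
lemma eq_of_pairingLE_zero {μ ν : SignedMeasure Phase} (h : PairingLE 1 μ ν 0) : μ = ν := by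
  have hs : ∀ ψ : Phase → ℝ, ContDiff ℝ ∞ ψ → HasCompactSupport ψ →
      ∫ᵛ z, ψ z ∂<•μ = ∫ᵛ z, ψ z ∂<•ν := by
    intro ψ hψ hc
    have hψ1 : ContDiff ℝ 1 ψ := hψ.of_le (by norm_num)
    obtain ⟨k₁, hk₁⟩ := hc.exists_bound_of_continuous hψ.continuous
    have hD : Continuous fun z : Phase => (1 + ‖z‖) • fderiv ℝ ψ z :=
      (continuous_const.add continuous_norm).smul (hψ1.continuous_fderiv one_ne_zero)
    obtain ⟨k₂, hk₂⟩ := ((hc.fderiv ℝ).smul_left (f := fun z => 1 + ‖z‖)).exists_bound_of_continuous hD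
    have hk₁0 : 0 ≤ k₁ := (norm_nonneg _).trans (hk₁ 0)
    have hk₂0 : 0 ≤ k₂ := (norm_nonneg _).trans (hk₂ 0)
    have := h.abs_sub_le (k := k₁ + k₂ + 1) (by positivity) hψ1 hc
      (fun z => (hk₁ z).trans (by linarith)) fun z => ?_
    · rw [mul_zero] at this
      exact sub_eq_zero.1 (abs_nonpos_iff.1 this)
    · have h2 := hk₂ z
      simp only [Pi.smul_apply', norm_smul, Real.norm_eq_abs] at h2
      rw [abs_of_nonneg (by positivity)] at h2
      rw [one_mul]
      linarith
  refine eq_of_integral_eq_on_compactlySupported fun f hf hc => eq_of_forall_dist_le fun ε hε => ?_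
  set A := μ.variation.real univ + ν.variation.real univ + 1
  have hμ0 : 0 ≤ μ.variation.real univ := measureReal_nonneg
  have hν0 : 0 ≤ ν.variation.real univ := measureReal_nonneg
  have hA : 0 < A := by positivity
  obtain ⟨ψ, hψ, hψc, hψf⟩ := exists_smooth_dist_le hf hc (ε := ε / A) (by positivity)
  have hdist : ∀ ρ : SignedMeasure Phase,
      ‖∫ᵛ z, ψ z ∂<•ρ - ∫ᵛ z, f z ∂<•ρ‖ ≤ ε / A * ρ.variation.real univ := by
    intro ρ
    rw [← VectorMeasure.integral_fun_sub (integrable_of_hasCompactSupport hψ.continuous hψc)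
      (integrable_of_hasCompactSupport hf hc)]
    exact norm_integral_le_mul_variation hψf (by positivity)
  have e : ∫ᵛ z, f z ∂<•μ - ∫ᵛ z, f z ∂<•ν = (∫ᵛ z, ψ z ∂<•ν - ∫ᵛ z, f z ∂<•ν) -
      (∫ᵛ z, ψ z ∂<•μ - ∫ᵛ z, f z ∂<•μ) := by rw [hs ψ hψ hψc]; ring
  rw [dist_eq_norm, e]
  refine ((norm_sub_le _ _).trans (add_le_add (hdist ν) (hdist μ))).trans ?_
  calc _ = ε / A * (A - 1) := by ring
    _ ≤ ε / A * A := by gcongr; linarith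
    _ = ε := by field_simp

/-- Weak solutions with the same initial value agree. -/
theorem IsCompactlyWeakSolution.eqOn (hg : IsC1b (∇ V) C) (hΔ : Δ.OrdConnected)
    (hΔ0 : (0 : ℝ) ∈ Δ) (h : IsCompactlyWeakSolution V Δ M)
    (h' : IsCompactlyWeakSolution V Δ M') (h0 : M' 0 = M 0) : EqOn M' M Δ := by
  intro t ht
  have hab : Icc (min 0 t) (max 0 t) ⊆ Δ := hΔ.uIcc_subset hΔ0 ht
  obtain ⟨m₁, hm₁⟩ := h.bounded _ _ hab
  obtain ⟨m₂, hm₂⟩ := h'.bounded _ _ hab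
  have h0m : (0 : ℝ) ∈ Icc (min 0 t) (max 0 t) := left_mem_uIcc
  have htm : t ∈ Icc (min 0 t) (max 0 t) := right_mem_uIcc
  set m := max m₁ m₂
  have hm : ∀ s ∈ Icc (min 0 t) (max 0 t), (M s).variation.real univ ≤ m := fun s hs =>
    (hm₁ s hs).trans (le_max_left _ _)
  have hm' : ∀ s ∈ Icc (min 0 t) (max 0 t), (M' s).variation.real univ ≤ m := fun s hs =>
    (hm₂ s hs).trans (le_max_right _ _)
  have hm0 : 0 ≤ m := measureReal_nonneg.trans (hm t htm)
  obtain ⟨k, hk0, hk⟩ := exists_gradConv_sub_le_of_pairingLE hg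
  set l := growthRate (C * m) + 2 * (k * m) + 1 with hl
  have hl0 : 0 ≤ l := by
    have := growthRate_pos (mul_nonneg hg.nonneg hm0)
    positivity
  -- The start is the trivial bound `2m` from the masses; each application of `pairingLE_half`
  -- halves it.
  have hind : ∀ n : ℕ, ∀ s ∈ Icc (min 0 t) (max 0 t), ∀ η, 0 < η → η ≤ 1 →
      PairingLE η (M' s) (M s) (2 * m / 2 ^ n * Real.exp (l * |s|)) := by
    intro n
    induction n with
    | zero =>
      intro s hs η _ _ φ hφ
      have h1 := norm_integral_le_mul_variation (μ := M' s) (f := φ) hφ.abs_le zero_le_one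
      have h2 := norm_integral_le_mul_variation (μ := M s) (f := φ) hφ.abs_le zero_le_one
      have he : 1 ≤ Real.exp (l * |s|) := Real.one_le_exp (by positivity)
      rw [pow_zero, div_one]
      rw [← Real.norm_eq_abs]
      refine (_root_.norm_sub_le _ _).trans ?_
      nlinarith [hm s hs, hm' s hs]
    | succ n ih =>
      intro s hs η hη hη1
      have := pairingLE_half hg h h' hab h0m h0 hm hm' hk0.le (by positivity) hk hl ih s hs η hη hη1
      rwa [div_div, ← pow_succ] at this
  refine eq_of_pairingLE_zero fun φ hφ => ge_of_tendsto' (f := fun n : ℕ =>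
    2 * m / 2 ^ n * Real.exp (l * |t|)) (x := atTop) ?_ fun n =>
      hind n t htm 1 one_pos le_rfl φ hφ
  have h2 : Tendsto (fun n : ℕ => 2 * m * (1 / 2 : ℝ) ^ n * Real.exp (l * |t|)) atTop
      (𝓝 (2 * m * 0 * Real.exp (l * |t|))) :=
    ((tendsto_pow_atTop_nhds_zero_of_lt_one (by norm_num) (by norm_num)).const_mul _).mul_const _
  simpa [div_eq_mul_inv] using h2

end

/-! ### Self-consistent characteristics by a weighted Picard iteration. -/

section

lemma norm_integral_le_exp_of_nonneg {E : Type*} [NormedAddCommGroup E] [NormedSpace ℝ E]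
    {F : ℝ → E} {A l t : ℝ} (hA : 0 ≤ A) (hl : 0 < l) (ht : 0 ≤ t)
    (hF : ∀ s, ‖F s‖ ≤ A * Real.exp (l * |s|)) :
    ‖∫ s in (0 : ℝ)..t, F s‖ ≤ A / l * Real.exp (l * t) := by
  have hd : ∀ s, HasDerivAt (fun s => A / l * Real.exp (l * s)) (A * Real.exp (l * s)) s := by
    intro s
    have h1 : HasDerivAt (fun s => l * s) l s := by simpa using (hasDerivAt_id s).const_mul l
    have h2 := h1.exp.const_mul (A / l)
    rwa [show A / l * (Real.exp (l * s) * l) = A * Real.exp (l * s) by field_simp] at h2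
  have hc : Continuous fun s => A * Real.exp (l * s) := by fun_prop
  refine (intervalIntegral.norm_integral_le_of_norm_le ht (ae_of_all _ fun s hs => ?_)
    (hc.intervalIntegrable 0 t)).trans ?_
  · simpa [abs_of_pos hs.1] using hF s
  · rw [intervalIntegral.integral_eq_sub_of_hasDerivAt (fun s _ => hd s)
      (hc.intervalIntegrable 0 t)]
    have : 0 ≤ A / l * Real.exp (l * 0) := by positivity
    linarith

/-- Integrating `exp (l|s|)` gains `1/l`; this is the source of the contraction, globally in time.
-/
lemma norm_exp_smul_integral_le {E : Type*} [NormedAddCommGroup E] [NormedSpace ℝ E]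
    {F : ℝ → E} {A l : ℝ} (hA : 0 ≤ A) (hl : 0 < l)
    (hF : ∀ s, ‖F s‖ ≤ A * Real.exp (l * |s|)) (t : ℝ) :
    ‖Real.exp (-(l * |t|)) • ∫ s in (0 : ℝ)..t, F s‖ ≤ A / l := by
  have key : ‖∫ s in (0 : ℝ)..t, F s‖ ≤ A / l * Real.exp (l * |t|) := by
    rcases le_total 0 t with ht | ht
    · rw [abs_of_nonneg ht]
      exact norm_integral_le_exp_of_nonneg hA hl ht hF
    · rw [abs_of_nonpos ht]
      have h1 := norm_integral_le_exp_of_nonneg (F := fun s => F (-s)) hA hl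
        (neg_nonneg.2 ht) fun s => by simpa using hF (-s)
      rwa [intervalIntegral.integral_comp_neg, neg_neg, neg_zero, intervalIntegral.integral_symm,
        norm_neg] at h1
  rw [norm_smul, Real.norm_eq_abs, Real.abs_exp, Real.exp_neg, inv_mul_le_iff₀ (Real.exp_pos _),
    mul_comm]
  exact key

/-- The free flow `(x, v) ↦ (x + 2tv, v)`. -/
def freeFlow (t : ℝ) (z : Phase) : Phase := (z.1 + (2 * t) • z.2, z.2)

lemma continuous_freeFlow : Continuous fun p : ℝ × Phase => freeFlow p.1 p.2 := by
  unfold freeFlow; fun_prop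

lemma hasDerivAt_freeFlow (t : ℝ) (z : Phase) :
    HasDerivAt (fun t => freeFlow t z) ((2 : ℝ) • z.2, 0) t := by
  have h1 : HasDerivAt (fun t : ℝ => z.1 + (2 * t) • z.2) ((2 : ℝ) • z.2) t := by
    simpa using ((((hasDerivAt_id t).const_mul 2).smul_const z.2).const_add z.1)
  exact h1.prodMk (hasDerivAt_const t z.2)

/-- The free flow perturbed by an exponentially weighted displacement. -/
def perturbedFlow (l : ℝ) (u : ℝ × Phase →ᵇ Phase) (t : ℝ) (z : Phase) : Phase :=
  freeFlow t z + Real.exp (l * |t|) • u (t, z)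

lemma continuous_perturbedFlow (l : ℝ) (u : ℝ × Phase →ᵇ Phase) :
    Continuous fun p : ℝ × Phase => perturbedFlow l u p.1 p.2 := by
  unfold perturbedFlow
  have := u.continuous
  exact continuous_freeFlow.add (by fun_prop)

/-- The time derivative of the displacement along the characteristics. -/
def displacementField (g : R3 → R3) (μ : SignedMeasure Phase) (l : ℝ)
    (u : ℝ × Phase →ᵇ Phase) (t : ℝ) (z : Phase) : Phase :=
  ((2 : ℝ) • Real.exp (l * |t|) • (u (t, z)).2,
    ∫ᵛ w, g ((perturbedFlow l u t z).1 - (perturbedFlow l u t w).1) ∂<•μ)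

section

variable {g : R3 → R3} {C : ℝ} {l : ℝ}

lemma integrable_comp_perturbedFlow (hg : IsC1b g C) (μ : SignedMeasure Phase)
    (u : ℝ × Phase →ᵇ Phase) (t : ℝ) (x : R3) :
    Integrable (fun w => g (x - (perturbedFlow l u t w).1)) μ.variation := by
  have : Continuous fun w => perturbedFlow l u t w :=
    (continuous_perturbedFlow l u).comp (by fun_prop : Continuous fun w : Phase => (t, w))
  exact integrable_of_norm_le (hg.continuous.comp (by fun_prop)) fun _ => hg.norm_le _

lemma continuous_displacementField (hg : IsC1b g C) (μ : SignedMeasure Phase)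
    (u : ℝ × Phase →ᵇ Phase) :
    Continuous fun p : ℝ × Phase => displacementField g μ l u p.1 p.2 := by
  have hu := u.continuous
  refine Continuous.prodMk (by fun_prop) ?_
  refine VectorMeasure.continuous_of_dominated (bound := fun _ => C)
    (fun p => (integrable_comp_perturbedFlow hg μ u p.1 _).1)
    (fun p => ae_of_all _ fun w => hg.norm_le _) (integrable_const C)
    (ae_of_all _ fun w => hg.continuous.comp (Continuous.sub ?_ ?_))
  · exact continuous_fst.comp (continuous_perturbedFlow l u)
  · exact continuous_fst.comp ((continuous_perturbedFlow l u).comp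
      (by fun_prop : Continuous fun p : ℝ × Phase => (p.1, w)))

lemma norm_displacementField_le (hg : IsC1b g C) (hl : 0 ≤ l) (μ : SignedMeasure Phase)
    (u : ℝ × Phase →ᵇ Phase) (t : ℝ) (z : Phase) : ‖displacementField g μ l u t z‖ ≤
      (2 * ‖u‖ + C * μ.variation.real univ) * Real.exp (l * |t|) := by
  have he : 1 ≤ Real.exp (l * |t|) := Real.one_le_exp (by positivity)
  have hm : 0 ≤ C * μ.variation.real univ := mul_nonneg hg.nonneg measureReal_nonneg
  rw [add_mul]
  refine max_le ?_ ?_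
  · refine le_trans ?_ (le_add_of_nonneg_right (by positivity))
    change ‖(2 : ℝ) • Real.exp (l * |t|) • (u (t, z)).2‖ ≤ _
    rw [norm_smul, norm_smul, Real.norm_two, Real.norm_eq_abs, Real.abs_exp, mul_assoc,
      mul_comm ‖u‖]
    gcongr
    exact (norm_snd_le _).trans (u.norm_coe_le_norm _)
  · refine le_trans ?_ (le_add_of_nonneg_left (by positivity))
    exact (norm_integral_le_mul_variation (fun _ => hg.norm_le _) hg.nonneg).trans
      (le_mul_of_one_le_right hm he)

/-- The velocity component contributes `2`. The force contributes `2C|μ|`, because both the particle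
at `z` and the source particle at `w` are displaced. -/
lemma norm_displacementField_sub_le (hg : IsC1b g C) (μ : SignedMeasure Phase)
    (u u' : ℝ × Phase →ᵇ Phase) (t : ℝ) (z : Phase) :
    ‖displacementField g μ l u t z - displacementField g μ l u' t z‖ ≤
      ((2 + 2 * (C * μ.variation.real univ)) * dist u u') * Real.exp (l * |t|) := by
  have hm : 0 ≤ C * μ.variation.real univ := mul_nonneg hg.nonneg measureReal_nonneg
  have hd : ∀ w, ‖u (t, w) - u' (t, w)‖ ≤ dist u u' := fun w => by
    rw [← dist_eq_norm]; exact BoundedContinuousFunction.dist_coe_le_dist _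
  have hE := Real.exp_pos (l * |t|)
  have hC := hg.nonneg
  have hp : ∀ w, ‖(perturbedFlow l u t w).1 - (perturbedFlow l u' t w).1‖ ≤
      Real.exp (l * |t|) * dist u u' := by
    intro w
    have e : perturbedFlow l u t w - perturbedFlow l u' t w =
        Real.exp (l * |t|) • (u (t, w) - u' (t, w)) := by
      rw [perturbedFlow, perturbedFlow, add_sub_add_left_eq_sub, smul_sub]
    have h1 := norm_fst_le (perturbedFlow l u t w - perturbedFlow l u' t w)
    rw [e, norm_smul, Real.norm_eq_abs, Real.abs_exp, ← e] at h1
    exact h1.trans (mul_le_mul_of_nonneg_left (hd w) hE.le)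
  refine max_le ?_ ?_
  · change ‖(2 : ℝ) • Real.exp (l * |t|) • (u (t, z)).2 -
      (2 : ℝ) • Real.exp (l * |t|) • (u' (t, z)).2‖ ≤ _
    rw [← smul_sub, ← smul_sub, norm_smul, norm_smul, Real.norm_two, Real.norm_eq_abs,
      Real.abs_exp]
    have h2 : ‖(u (t, z)).2 - (u' (t, z)).2‖ ≤ dist u u' :=
      (norm_snd_le (u (t, z) - u' (t, z))).trans (hd z)
    have h3 : 0 ≤ C * μ.variation.real univ * dist u u' * Real.exp (l * |t|) := by positivity
    nlinarith [mul_le_mul_of_nonneg_left h2 hE.le]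
  · change ‖(∫ᵛ w, g ((perturbedFlow l u t z).1 - (perturbedFlow l u t w).1) ∂<•μ) -
      ∫ᵛ w, g ((perturbedFlow l u' t z).1 - (perturbedFlow l u' t w).1) ∂<•μ‖ ≤ _
    rw [← VectorMeasure.integral_fun_sub (integrable_comp_perturbedFlow hg μ u t _)
      (integrable_comp_perturbedFlow hg μ u' t _)]
    refine (norm_integral_le_mul_variation (C := C * (2 * (Real.exp (l * |t|) * dist u u')))
      (fun w => ?_) (by positivity)).trans ?_
    · refine (hg.norm_sub_le _ _).trans (mul_le_mul_of_nonneg_left ?_ hC)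
      rw [sub_sub_sub_comm]
      refine (_root_.norm_sub_le _ _).trans ?_
      linarith [hp z, hp w]
    · have : 0 ≤ 2 * dist u u' * Real.exp (l * |t|) := by positivity
      nlinarith

/-- The Picard map for exponentially weighted displacements. -/
def picardMap (hg : IsC1b g C) (hl : 0 < l) (μ : SignedMeasure Phase)
    (u : ℝ × Phase →ᵇ Phase) : ℝ × Phase →ᵇ Phase :=
  BoundedContinuousFunction.ofNormedAddCommGroup
    (fun p => Real.exp (-(l * |p.1|)) • ∫ s in (0 : ℝ)..p.1, displacementField g μ l u s p.2)
    (by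
      refine Continuous.smul
        (by fun_prop : Continuous fun p : ℝ × Phase => Real.exp (-(l * |p.1|))) ?_
      refine intervalIntegral.continuous_parametric_intervalIntegral_of_continuous
        (f := fun (p : ℝ × Phase) s => displacementField g μ l u s p.2) ?_ continuous_fst
      exact (continuous_displacementField hg μ u).comp
        (by fun_prop : Continuous fun q : (ℝ × Phase) × ℝ => (q.2, q.1.2)))
    ((2 * ‖u‖ + C * μ.variation.real univ) / l)
    (fun p => norm_exp_smul_integral_le
      (add_nonneg (by positivity) (mul_nonneg hg.nonneg measureReal_nonneg)) hl
      (fun s => norm_displacementField_le hg hl.le μ u s p.2) p.1)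

lemma contractingWith_picardMap (hg : IsC1b g C) (hl : 0 < l) (μ : SignedMeasure Phase)
    (hlC : 2 * (2 + 2 * (C * μ.variation.real univ)) ≤ l) :
    ContractingWith (1 / 2) (picardMap hg hl μ) := by
  have hm : 0 ≤ C * μ.variation.real univ := mul_nonneg hg.nonneg measureReal_nonneg
  refine ⟨by norm_num, LipschitzWith.of_dist_le_mul fun u u' => ?_⟩
  refine (BoundedContinuousFunction.dist_le (by positivity)).2 fun p => ?_
  have hi : ∀ u : ℝ × Phase →ᵇ Phase, IntervalIntegrable
      (fun s => displacementField g μ l u s p.2) volume 0 p.1 := fun u =>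
    ((continuous_displacementField hg μ u).comp
      (by fun_prop : Continuous fun s : ℝ => (s, p.2))).intervalIntegrable _ _
  have e : picardMap hg hl μ u p - picardMap hg hl μ u' p = Real.exp (-(l * |p.1|)) •
      ∫ s in (0 : ℝ)..p.1, (displacementField g μ l u s p.2 - displacementField g μ l u' s p.2) := by
    rw [intervalIntegral.integral_sub (hi u) (hi u'), smul_sub]
    rfl
  rw [dist_eq_norm, e]
  refine (norm_exp_smul_integral_le (by positivity) hl
    (fun s => norm_displacementField_sub_le hg μ u u' s p.2) p.1).trans ?_
  rw [div_le_iff₀ hl]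
  have := mul_le_mul_of_nonneg_right hlC (dist_nonneg (x := u) (y := u'))
  push_cast
  linarith

/-- The self-consistent characteristic flow of the Vlasov equation exists globally in time. -/
theorem exists_characteristics (hg : IsC1b g C) (μ : SignedMeasure Phase) :
    ∃ Φ : ℝ → Phase → Phase, (Continuous fun p : ℝ × Phase => Φ p.1 p.2) ∧ (∀ z, Φ 0 z = z) ∧
      ∀ t z, HasDerivAt (fun t => Φ t z)
        ((2 : ℝ) • (Φ t z).2, ∫ᵛ w, g ((Φ t z).1 - (Φ t w).1) ∂<•μ) t := by
  have hm : 0 ≤ C * μ.variation.real univ := mul_nonneg hg.nonneg measureReal_nonneg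
  -- The Lipschitz constant of the displacement field divided by `l` must be at most `1/2`; `l` is
  -- kept abstract afterwards.
  obtain ⟨l, hlC⟩ : ∃ l, 2 * (2 + 2 * (C * μ.variation.real univ)) ≤ l := ⟨_, le_rfl⟩
  have hl : 0 < l := by linarith
  have hT := contractingWith_picardMap hg hl μ hlC
  set u := ContractingWith.fixedPoint (picardMap hg hl μ) hT
  have hu : picardMap hg hl μ u = u := hT.fixedPoint_isFixedPt
  have hint : ∀ t z, perturbedFlow l u t z =
      freeFlow t z + ∫ s in (0 : ℝ)..t, displacementField g μ l u s z := by
    intro t z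
    have h1 : u (t, z) = Real.exp (-(l * |t|)) •
        ∫ s in (0 : ℝ)..t, displacementField g μ l u s z :=
      (DFunLike.congr_fun hu (t, z)).symm
    rw [perturbedFlow, h1, smul_smul, ← Real.exp_add, add_neg_cancel, Real.exp_zero, one_smul]
  refine ⟨perturbedFlow l u, continuous_perturbedFlow l u, fun z => ?_, fun t z => ?_⟩
  · rw [hint, intervalIntegral.integral_same, add_zero, freeFlow, mul_zero, zero_smul, add_zero]
  · have hc : Continuous fun s => displacementField g μ l u s z :=
      (continuous_displacementField hg μ u).comp (by fun_prop : Continuous fun s : ℝ => (s, z))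
    have hd := (hasDerivAt_freeFlow t z).add
      (intervalIntegral.integral_hasDerivAt_right (hc.intervalIntegrable 0 t)
        (hc.stronglyMeasurableAtFilter _ _) hc.continuousAt)
    have e : (fun t => perturbedFlow l u t z) = (fun t => freeFlow t z) + fun t =>
        ∫ s in (0 : ℝ)..t, displacementField g μ l u s z := funext fun t => hint t z
    rw [e]
    refine hd.congr_deriv ?_
    rw [displacementField, Prod.mk_add_mk, zero_add, ← smul_add]
    rfl

end

end

/-! ### Existence by push-forward along the characteristics. -/

section

variable {V : R3 → ℝ} {C : ℝ}

lemma compactTests_subset_schwartzTests : compactTests ⊆ schwartzTests :=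
  fun _ h => ⟨h.2.toSchwartzMap h.1, rfl⟩

lemma IsWeakSolution.anti {𝒯 𝒯' : Set (Phase → ℝ)} (h𝒯 : 𝒯' ⊆ 𝒯) {Δ : Set ℝ}
    {M : ℝ → SignedMeasure Phase} (h : IsWeakSolution 𝒯 V Δ M) : IsWeakSolution 𝒯' V Δ M :=
  ⟨h.isFamily, fun φ hφ => h.hasDerivAt φ (h𝒯 hφ)⟩

lemma integral_map_of_continuous {E : Type*} [NormedAddCommGroup E] [NormedSpace ℝ E]
    {μ : SignedMeasure Phase} {Φ : Phase → Phase} (hΦ : Continuous Φ) {f : Phase → E}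
    [SecondCountableTopologyEither Phase E] (hf : Continuous f) {K : ℝ} (hK : ∀ z, ‖f z‖ ≤ K) :
    ∫ᵛ z, f z ∂<•(μ.map Φ) = ∫ᵛ z, f (Φ z) ∂<•μ :=
  VectorMeasure.integral_map hΦ.measurable hf.aestronglyMeasurable
    (integrable_of_norm_le (hf.comp hΦ) fun _ => hK _)

lemma variation_map_univ_le (μ : SignedMeasure Phase) {Φ : Phase → Phase}
    (hΦ : Continuous Φ) : (μ.map Φ).variation univ ≤ μ.variation univ := by
  refine (VectorMeasure.variation_map_le univ).trans ?_
  rw [Measure.map_apply hΦ.measurable MeasurableSet.univ, preimage_univ]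

/-- Rapid decay bounds both `‖Dh‖` and `‖z‖‖Dh‖`, which handles a field of linear growth and
provides a constant dominating function. -/
lemma exists_fderiv_apply_le_of_schwartz (h : 𝓢(Phase, ℝ)) {c : ℝ} (hc : 0 ≤ c) :
    ∃ K, ∀ z v : Phase, ‖v‖ ≤ 2 * ‖z‖ + c → ‖fderiv ℝ h z v‖ ≤ K := by
  obtain ⟨K₀, -, h₀⟩ := h.decay 0 1
  obtain ⟨K₁, -, h₁⟩ := h.decay 1 1
  refine ⟨2 * K₁ + c * K₀, fun z v hv => ?_⟩
  have h0 := h₀ z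
  have h1 := h₁ z
  rw [norm_iteratedFDeriv_one] at h0 h1
  rw [pow_zero, one_mul] at h0
  rw [pow_one] at h1
  refine (ContinuousLinearMap.le_opNorm_of_le _ hv).trans ?_
  nlinarith [norm_nonneg (fderiv ℝ h z)]

/-- The push-forward along the characteristics is a weak solution for Schwartz tests. -/
theorem exists_isWeakSolution (hg : IsC1b (∇ V) C) (μ : SignedMeasure Phase) (Δ : Set ℝ) :
    ∃ M : ℝ → SignedMeasure Phase, IsWeakSolution schwartzTests V Δ M ∧ M 0 = μ := by
  obtain ⟨Φ, hΦ, hΦ0, hΦd⟩ := exists_characteristics hg μ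
  have hΦt : ∀ t, Continuous (Φ t) := fun t =>
    hΦ.comp (by fun_prop : Continuous fun z : Phase => (t, z))
  have hΦz : ∀ z, Continuous fun t => Φ t z := fun z =>
    hΦ.comp (by fun_prop : Continuous fun t : ℝ => (t, z))
  have hgrad : ∀ t x, gradConv V (μ.map (Φ t)) x = ∫ᵛ w, ∇ V (x - (Φ t w).1) ∂<•μ := fun t x =>
    integral_map_of_continuous (f := fun w : Phase => ∇ V (x - w.1)) (hΦt t)
      (hg.continuous.comp (by fun_prop)) fun _ => hg.norm_le _
  -- By the change of variables, the force generated by the transported particles is the force of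
  -- the push-forward measure, so `Φ` follows the field of the solution itself.
  have hfield : ∀ t z, HasDerivAt (fun t => Φ t z) (field V (μ.map (Φ t)) (Φ t z)) t := by
    intro t z
    rw [field, hgrad]
    exact hΦd t z
  have hvar : ∀ t, (μ.map (Φ t)).variation univ ≤ μ.variation univ := fun t =>
    variation_map_univ_le μ (hΦt t)
  refine ⟨fun t => μ.map (Φ t), ⟨⟨fun I _ _ _ => ?_, fun x => ?_⟩, ?_⟩, ?_⟩
  · refine ⟨(μ.variation univ).toNNReal + 1, ?_⟩
    refine (iSup₂_le fun t _ => (supNorm_le_variation _).trans (hvar t)).trans_lt ?_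
    rw [ENNReal.coe_add, ENNReal.coe_toNNReal (measure_ne_top _ _), ENNReal.coe_one]
    exact ENNReal.lt_add_right (measure_ne_top _ _) one_ne_zero
  · simp_rw [hgrad]
    refine Continuous.continuousOn (VectorMeasure.continuous_of_dominated (bound := fun _ => C)
      (fun t => ?_) (fun t => ae_of_all _ fun w => hg.norm_le _) (integrable_const C)
      (ae_of_all _ fun w => hg.continuous.comp
        (continuous_const.sub (continuous_fst.comp (hΦz w)))))
    exact (hg.continuous.comp
      (continuous_const.sub (continuous_fst.comp (hΦt t)))).aestronglyMeasurable
  · rintro _ ⟨h, rfl⟩ t -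
    have hh : ContDiff ℝ 1 h := h.smooth 1
    have hbdd : ∃ K, ∀ z, ‖h z‖ ≤ K := by
      obtain ⟨K, -, hK⟩ := h.decay 0 0
      exact ⟨K, fun z => by simpa using hK z⟩
    obtain ⟨K, hK⟩ := hbdd
    have hcm : 0 ≤ C * μ.variation.real univ := mul_nonneg hg.nonneg measureReal_nonneg
    obtain ⟨K', hK'⟩ := exists_fderiv_apply_le_of_schwartz h hcm
    have hb : ∀ t z, ‖fderiv ℝ h z (field V (μ.map (Φ t)) z)‖ ≤ K' := fun t z =>
      hK' z _ (norm_field_le (fun x => (norm_gradConv_le hg _ x).trans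
        (mul_le_mul_of_nonneg_left (ENNReal.toReal_mono (measure_ne_top _ _) (hvar t))
          hg.nonneg)) z)
    have hfc : ∀ t, Continuous fun z => fderiv ℝ h z (field V (μ.map (Φ t)) z) := fun t =>
      continuous_fderiv_apply hh (contDiff_field hg _).continuous
    simp only [fieldA_add_fieldBConv hg]
    rw [integral_map_of_continuous (hΦt t) (hfc t) (hb t)]
    simp_rw [fun s => integral_map_of_continuous (μ := μ) (hΦt s) h.continuous hK]
    refine hasDerivAt_integral (s := univ) (C := K')
      (f' := fun t z => fderiv ℝ h (Φ t z) (field V (μ.map (Φ t)) (Φ t z))) univ_mem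
      (fun r => integrable_of_norm_le (h.continuous.comp (hΦt r)) fun z => hK _)
      ((hfc t).comp (hΦt t)).aestronglyMeasurable (fun z r _ => hb r _) fun z r _ => ?_
    exact (hh.differentiable one_ne_zero _).hasFDerivAt.comp_hasDerivAt r (hfield r z)
  · have e : Φ 0 = id := funext hΦ0
    simp only [e, VectorMeasure.map_id]

end

end Vlasov

end

theorem propositionA1 (V : Vlasov.R3 → ℝ) (hV : Vlasov.IsC2b V)
    (μ₀ : MeasureTheory.SignedMeasure Vlasov.Phase)
    (Δ : Set ℝ) (hΔopen : IsOpen Δ) (hΔint : Δ.OrdConnected) (hΔ0 : (0 : ℝ) ∈ Δ)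
    (𝒯 : Set (Vlasov.Phase → ℝ))
    (h𝒯 : 𝒯 = Vlasov.compactTests ∨ 𝒯 = Vlasov.schwartzTests) :
    ∃ M : ℝ → MeasureTheory.SignedMeasure Vlasov.Phase,
      (Vlasov.IsWeakSolution 𝒯 V Δ M ∧ M 0 = μ₀) ∧
      ∀ M' : ℝ → MeasureTheory.SignedMeasure Vlasov.Phase,
        Vlasov.IsWeakSolution 𝒯 V Δ M' ∧ M' 0 = μ₀ → Set.EqOn M' M Δ := by
  obtain ⟨C, hg⟩ := hV.exists_isC1b_gradient
  -- Existence is strongest for the larger test class and uniqueness for the smaller one, so both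
  -- cases follow by inclusion.
  have h1 : 𝒯 ⊆ Vlasov.schwartzTests := by
    rcases h𝒯 with rfl | rfl
    exacts [Vlasov.compactTests_subset_schwartzTests, subset_rfl]
  have h2 : Vlasov.compactTests ⊆ 𝒯 := by
    rcases h𝒯 with rfl | rfl
    exacts [subset_rfl, Vlasov.compactTests_subset_schwartzTests]
  obtain ⟨M, hM, hM0⟩ := Vlasov.exists_isWeakSolution hg μ₀ Δ
  refine ⟨M, ⟨hM.anti h1, hM0⟩, fun M' hM' => ?_⟩
  exact Vlasov.IsCompactlyWeakSolution.eqOn hg hΔint hΔ0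
    ((hM.anti (h2.trans h1)).isCompactlyWeakSolution hg hΔopen)
    ((hM'.1.anti h2).isCompactlyWeakSolution hg hΔopen) (hM'.2.trans hM0.symm)
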